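/- Let $n\ge 0$, $L>0$, $\Pi=[-L,L]^n$, and let $\mathbb{H}$ be the Hilbert space of functions $Y(x,v)$ of $(x,v)\in\mathbb{R}^n\times[0,1]$ that are $2L$-periodic in each coordinate of $x$, with norm $\|Y\|^2=\int_\Pi\int_0^1 Y^2\,dv\,dx<\infty$ and the corresponding inner product $\langle\cdot,\cdot\rangle$. Let $K\subset\mathbb{H}$ be the closed convex cone of functions that are non-decreasing in $v$. For $Y\in K$ put $$T_K(Y)=\overline{\{h(\tilde Y-Y): h\ge 0,\ \tilde Y\in K\}},\qquad \partial K(Y)=\{Z\in\mathbb{H}:\langle Z,\tilde Y-Y\rangle\le 0\ \text{ for all }\tilde Y\in K\},$$ the closure being taken in $\mathbb{H}$. Let $f:[0,1]\to\mathbb{R}^n$ be Lipschitz continuous, with a.e. derivative $f_v$, and let $\nabla_x$ be the weak gradient in $x$. Let $Y_0\in K$ with $\nabla_xY_0\in\mathbb{H}$ (all components in $\mathbb{H}$). An admissible curve is a locally absolutely continuous $Y\in C([0,\infty);\mathbb{H})$ (that is, $\partial_tY\in L^1_{loc}([0,\infty);\mathbb{H})$ and $Y(t)=Y(0)+\int_0^t\partial_tY\,ds$)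 with $Y(0)=Y_0$ and $Y(t)\in K$ for all $t\ge0$. It is a solution if for a.e. $t>0$ $$\nabla_xY(t)\in\mathbb{H}\quad\text{and}\quad \partial_tY(t)+f_v\cdot\nabla_xY(t)\in-\partial K(Y(t)).\qquad (1)$$ **Theorem.** There is exactly one solution $Y$; moreover $\partial_tY$ and $\nabla_xY$ are essentially bounded on $(0,\infty)$ with values in $\mathbb{H}$. For a.e. $t>0$ the solution satisfies (i) $\|\partial_tY(t)\|=\min_{Z\in\partial K(Y(t))}\|Z+f_v\cdot\nabla_xY(t)\|$, and the minimum is attained at a $Z\in\partial K(Y(t))$ with $\partial_tY(t)=-(Z+f_v\cdot\nabla_xY(t))$; that is, $\partial_tY(t)$ is the element of minimal norm of $-(f_v\cdot\nabla_xY(t)+\partial K(Y(t)))$; (ii) $\|\partial_tY(t)+f_v\cdot\nabla_xY(t)\|=\min_{V\in T_K(Y(t))}\|V+f_v\cdot\nabla_xY(t)\|$, and $\partial_tY(t)\in T_K(Y(t))$; that is, $\partial_tY(t)$ minimizes the interaction functional over the tangent cone. Conversely, each of the two conditions determines the solution uniquely: if $Y'$ is an admissible curve such that, for a.e. $t>0$,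 $\nabla_xY'(t)\in\mathbb{H}$ and $Y'$ satisfies (i), then $Y'=Y$ on $[0,\infty)$; and if $Y'$ is an admissible curve such that, for a.e. $t>0$, $\nabla_xY'(t)\in\mathbb{H}$ and the equality of norms in (ii) holds for $Y'$, then $Y'=Y$ on $[0,\infty)$. -/

import Mathlib

open MeasureTheory Set
open scoped ContDiff

noncomputable section

/-- The torus `(ℝ / 2Lℤ)ⁿ`. Functions on it are the `2L`-periodic functions of `x ∈ ℝⁿ`, and its
volume is Lebesgue measure on the period cell `[-L, L]ⁿ`. -/
abbrev Torus (n : ℕ) (L : ℝ) : Type := Fin n → AddCircle (2 * L)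

/-- The Hilbert space `ℍ` of functions `Y(x, u)`, `2L`-periodic in `x ∈ ℝⁿ`, `u ∈ [0,1]`, with
`‖Y‖² = ∫_{[-L,L]ⁿ} ∫₀¹ Y² du dx`. -/
abbrev KineticSpace (n : ℕ) (L : ℝ) [Fact (0 < 2 * L)] : Type :=
  Lp ℝ 2 (volume : Measure (Torus n L × unitInterval))

/-- The cone `K` of the `Y ∈ ℍ` that are non-decreasing in `u`: for almost every `x`, the function
`u ↦ Y(x, u)` is non-decreasing off a null set of `u`. -/
def monotoneCone (n : ℕ) (L : ℝ) [Fact (0 < 2 * L)] : Set (KineticSpace n L) :=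
  {Y | ∀ᵐ x : Torus n L, ∃ S : Set unitInterval,
    (∀ᵐ u : unitInterval, u ∈ S) ∧ MonotoneOn (fun u => Y (x, u)) S}

section Cones

variable {E : Type*} [NormedAddCommGroup E] [InnerProductSpace ℝ E]

/-- The tangent cone `T_K(Y)`: the closure of `{h (W - Y) : h ≥ 0, W ∈ K}`. -/
def tangentConeTo (K : Set E) (Y : E) : Set E :=
  closure {V | ∃ h : ℝ, 0 ≤ h ∧ ∃ W ∈ K, V = h • (W - Y)}

/-- The normal cone `∂K(Y)` (for `Y ∈ K`, the subdifferential of the indicator function of `K`). -/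
def normalConeTo (K : Set E) (Y : E) : Set E :=
  {Z | ∀ W ∈ K, inner ℝ Z (W - Y) ≤ 0}

end Cones

/-- Test functions `φ(x, u)`: smooth in `(x, u) ∈ ℝⁿ × ℝ` and `2L`-periodic in `x`. -/
def IsTestFunction {n : ℕ} {L : ℝ} (φ : Torus n L → ℝ → ℝ) : Prop :=
  ContDiff ℝ ∞ (fun p : (Fin n → ℝ) × ℝ => φ (fun i => (p.1 i : AddCircle (2 * L))) p.2)

/-- The partial derivative `∂φ/∂x_i` of a function on the torus. -/
def torusPartial {n : ℕ} {L : ℝ} (i : Fin n) (φ : Torus n L → ℝ) (x : Torus n L) : ℝ :=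
  deriv (fun s : ℝ => φ (x + Pi.single i (s : AddCircle (2 * L)))) 0

/-- `G = ∇ₓ Y` weakly, with all components of `G` in `ℍ`. -/
def IsWeakGrad {n : ℕ} {L : ℝ} [Fact (0 < 2 * L)]
    (Y : KineticSpace n L) (G : Fin n → KineticSpace n L) : Prop :=
  ∀ (i : Fin n) (φ : Torus n L → ℝ → ℝ), IsTestFunction φ →
    ∫ p : Torus n L × unitInterval, Y p * torusPartial i (fun x => φ x p.2) p.1 =
      -∫ p : Torus n L × unitInterval, G i p * φ p.1 p.2

/-- `∇ₓ Y ∈ ℍ` and `B = f_v · ∇ₓ Y`. Here `f_v` is the almost everywhere defined derivative of the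
Lipschitz flux `f`. -/
def IsTransport {n : ℕ} {L : ℝ} [Fact (0 < 2 * L)] (f : ℝ → EuclideanSpace ℝ (Fin n))
    (Y B : KineticSpace n L) : Prop :=
  ∃ G : Fin n → KineticSpace n L, IsWeakGrad Y G ∧
    ∀ᵐ p : Torus n L × unitInterval, B p = ∑ i, deriv f (p.2 : ℝ) i * G i p

/-- `Y ∈ C([0,∞); ℍ)` is a curve in `K` starting at `Y₀` that is locally absolutely continuous,
i.e. `∂_t Y ∈ L¹_loc` and `Y` is the integral of `∂_t Y`. Values at `t < 0` play no role. -/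
structure IsAdmissibleCurve {n : ℕ} {L : ℝ} [Fact (0 < 2 * L)] (Y₀ : KineticSpace n L)
    (Y : ℝ → KineticSpace n L) : Prop where
  continuousOn : ContinuousOn Y (Ici 0)
  initial : Y 0 = Y₀
  mem_cone : ∀ t, 0 ≤ t → Y t ∈ monotoneCone n L
  integrable_deriv : ∀ t, 0 ≤ t → IntervalIntegrable (deriv Y) volume 0 t
  eq_integral : ∀ t, 0 ≤ t → Y t = Y 0 + ∫ s in (0 : ℝ)..t, deriv Y s

/-- `∂_t Y + f_v · ∇ₓ Y ∈ -∂K(Y)` at time `t`. -/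
def InclusionAt {n : ℕ} {L : ℝ} [Fact (0 < 2 * L)] (f : ℝ → EuclideanSpace ℝ (Fin n))
    (Y : ℝ → KineticSpace n L) (t : ℝ) : Prop :=
  ∃ B, IsTransport f (Y t) B ∧ -(deriv Y t + B) ∈ normalConeTo (monotoneCone n L) (Y t)

/-- `Y` solves the Cauchy problem `∂_t Y + f_v · ∇ₓ Y ∈ -∂K(Y)`, `Y(0) = Y₀`. -/
def IsSolution {n : ℕ} {L : ℝ} [Fact (0 < 2 * L)] (f : ℝ → EuclideanSpace ℝ (Fin n))
    (Y₀ : KineticSpace n L) (Y : ℝ → KineticSpace n L) : Prop :=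
  IsAdmissibleCurve Y₀ Y ∧ ∀ᵐ t ∂(volume.restrict (Ioi (0 : ℝ))), InclusionAt f Y t

/-- The slow solution property at time `t`:
`‖∂_t Y‖ = min {‖Z + f_v · ∇ₓ Y‖ : Z ∈ ∂K(Y)}`, the minimum being attained by the `Z` with
`Z + f_v · ∇ₓ Y = -∂_t Y`. -/
def SlowAt {n : ℕ} {L : ℝ} [Fact (0 < 2 * L)] (f : ℝ → EuclideanSpace ℝ (Fin n))
    (Y : ℝ → KineticSpace n L) (t : ℝ) : Prop :=
  ∃ B, IsTransport f (Y t) B ∧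
    IsLeast ((fun Z => ‖Z + B‖) '' normalConeTo (monotoneCone n L) (Y t)) ‖deriv Y t‖ ∧
    -deriv Y t ∈ (fun Z => Z + B) '' normalConeTo (monotoneCone n L) (Y t)

/-- Minimality of the interaction functional at time `t`:
`‖∂_t Y + f_v · ∇ₓ Y‖ = min {‖V + f_v · ∇ₓ Y‖ : V ∈ T_K(Y)}`. -/
def MinimalInteractionAt {n : ℕ} {L : ℝ} [Fact (0 < 2 * L)] (f : ℝ → EuclideanSpace ℝ (Fin n))
    (Y : ℝ → KineticSpace n L) (t : ℝ) : Prop :=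
  ∃ B, IsTransport f (Y t) B ∧
    IsLeast ((fun V => ‖V + B‖) '' tangentConeTo (monotoneCone n L) (Y t)) ‖deriv Y t + B‖

end

/-!
The scalar conservation law is an evolution inclusion in the Hilbert space `ℍ`: free
transport `Y(x, u) ↦ Y(x - h f_v(u), u)` is a group of isometries with skew-symmetric generator
`-f_v · ∇ₓ`, and the normal cone of `K` is monotone.

*Regularity as translation invariance.* The weak gradient of `Y` is the derivative of `Y` along the
coordinate translations in `ℍ` (`isWeakGrad_iff_hasDerivAt`), and it exists with components of norm
at most `M` as soon as `Y` is `M`-Lipschitz under translations (`exists_isWeakGrad_of_mem`). Free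
transport is differentiable at every such `Y`, although `f_v` is only bounded and measurable,
because multiplication by a function of `u` commutes with translations (`hasDerivAt_shearGroup`).
Transport and the metric projection `P` onto `K` are non-expansive and commute with translations,
so both preserve the set of `M`-Lipschitz elements.

*Existence.* The curve is the limit of the splitting scheme `Y ↦ P (S_h Y)` along `h = 2⁻ᵐ`.
Comparing one step of length `2h` with two of length `h`, the squared distance grows by at most
`(C h)²` (`sq_norm_splitStep_sub_le`), so after time `t` the distance is of order `√(t h)`, which is
summable over dyadic step sizes. The limit is Lipschitz in time and satisfies an evolution
variational inequality with every regular competitor in `K` (`exists_splitting_limit`). A Lipschitz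
curve in a Hilbert space is differentiable almost everywhere (`lipschitz_curve_ae_hasDerivAt`), and
at such a time the inequality is the inclusion, first for regular competitors and then for all of
`K`, since projections of test functions are regular and dense (`mem_normalConeTo_of_regular`).

*Uniqueness.* For two solutions `‖Y - Y'‖²` is absolutely continuous with non-positive derivative
(`IsSolution.eqOn`).

*The two minimum properties.* At a time of differentiability both `∂ₜY` and `-∂ₜY` lie in the
tangent cone, so `∂ₜY` is orthogonal to every normal vector; both minimum properties follow from
this (`isLeast_norm_deriv`, `isLeast_norm_deriv_add`). Conversely, the first property contains the
inclusion, and the second gives it as the first-order condition for a minimum over a convex cone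
(`neg_mem_normalConeTo_of_isLeast`), so each of them reduces to uniqueness of solutions.
-/

namespace Kinetic

open Filter Topology
open scoped RealInnerProductSpace

section Hilbert

variable {E : Type*} [NormedAddCommGroup E] [InnerProductSpace ℝ E]

/-! ### Weak limits and Lipschitz curves in a Hilbert space -/

/-- A bounded sequence in a Hilbert space has a weak cluster point (Banach–Alaoglu), recorded only
through the inner products that converge along the whole sequence. -/
theorem exists_weak_limit [CompleteSpace E] {M : ℝ} (x : ℕ → E) (hx : ∀ k, ‖x k‖ ≤ M) :
    ∃ g : E, ‖g‖ ≤ M ∧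
      ∀ v a, Tendsto (fun k => ⟪x k, v⟫) atTop (𝓝 a) → ⟪g, v⟫ = a := by
  let y : ℕ → WeakDual ℝ E := fun k => StrongDual.toWeakDual (InnerProductSpace.toDual ℝ E (x k))
  have hy : ∀ k, y k ∈ WeakDual.toStrongDual ⁻¹' Metric.closedBall (0 : StrongDual ℝ E) M := by
    intro k
    simpa [y] using hx k
  obtain ⟨z, hz, hlim⟩ := (WeakDual.isCompact_closedBall (0 : StrongDual ℝ E) M).ultrafilter_le_nhds
    ((hyperfilter ℕ).map y) (by
      rw [Ultrafilter.coe_map, le_principal_iff, mem_map]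
      exact Eventually.of_forall hy)
  refine ⟨(InnerProductSpace.toDual ℝ E).symm (WeakDual.toStrongDual z), ?_, fun v a hv => ?_⟩
  · simpa using hz
  · have h1 : Tendsto (fun k => y k v) (hyperfilter ℕ) (𝓝 (z v)) :=
      ((WeakDual.eval_continuous v).tendsto z).comp (by simpa [Tendsto] using hlim)
    have h2 : Tendsto (fun k => y k v) (hyperfilter ℕ) (𝓝 a) :=
      hv.mono_left Nat.hyperfilter_le_atTop
    have h3 := tendsto_nhds_unique h1 h2
    rw [InnerProductSpace.toDual_symm_apply]
    exact h3

/-- A Lipschitz curve in a Hilbert space is the integral of a weak `L²` limit of its difference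
quotients. -/
theorem exists_density_of_lipschitz [CompleteSpace E] {C : NNReal} {Y : ℝ → E}
    (hY : LipschitzWith C Y) (T : ℝ) :
    ∃ g : ℝ → E, IntegrableOn g (Ioc 0 T) ∧
      ∀ t ∈ Icc 0 T, Y t - Y 0 = ∫ s in (0 : ℝ)..t, g s := by
  let μ : Measure ℝ := volume.restrict (Ioc 0 T)
  let q : ℕ → ℝ → E := fun k s => ((k : ℝ) + 1) • (Y (s + 1 / ((k : ℝ) + 1)) - Y s)
  have hpos : ∀ k : ℕ, (0 : ℝ) < (k : ℝ) + 1 := fun k => by positivity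
  have hqc : ∀ k, Continuous (q k) := fun k => by
    have := hY.continuous
    fun_prop
  have hqb : ∀ k s, ‖q k s‖ ≤ C := by
    intro k s
    have h := hY.dist_le_mul (s + 1 / ((k : ℝ) + 1)) s
    rw [dist_eq_norm, Real.dist_eq, add_sub_cancel_left,
      abs_of_pos (by have := hpos k; positivity)] at h
    rw [norm_smul, Real.norm_of_nonneg (hpos k).le]
    calc ((k : ℝ) + 1) * ‖Y (s + 1 / ((k : ℝ) + 1)) - Y s‖
        ≤ ((k : ℝ) + 1) * (C * (1 / ((k : ℝ) + 1))) := by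
          have := hpos k
          gcongr
      _ = C := by have := (hpos k).ne'; field_simp
  have hmem : ∀ k, MemLp (q k) 2 μ := fun k =>
    MemLp.of_bound (hqc k).aestronglyMeasurable C
      (ae_of_all _ (hqb k))
  obtain ⟨g, -, hg⟩ := exists_weak_limit (fun k => (hmem k).toLp (q k))
    (M := (μ univ).toReal ^ (2 : ENNReal).toReal⁻¹ * C) (fun k => by
      refine Lp.norm_le_of_ae_bound C.2 ?_
      filter_upwards [(hmem k).coeFn_toLp] with s hs
      rw [hs]
      exact hqb k s)
  have hgi : Integrable g μ := (Lp.memLp g).integrable (by norm_num)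
  refine ⟨g, hgi, fun t ht => ?_⟩
  have hsub : Ioc 0 t ⊆ Ioc 0 T := Ioc_subset_Ioc_right ht.2
  have hres : ∀ φ : ℝ → E, ∫ s in Ioc 0 t, φ s ∂μ = ∫ s in (0 : ℝ)..t, φ s := by
    intro φ
    rw [Measure.restrict_restrict measurableSet_Ioc, inter_eq_left.2 hsub,
      intervalIntegral.integral_of_le ht.1]
  have hF : ∀ t, HasDerivAt (fun r => ∫ s in (0 : ℝ)..r, Y s) (Y t) t := fun t =>
    intervalIntegral.integral_hasDerivAt_right (hY.continuous.intervalIntegrable _ _)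
      (hY.continuous.stronglyMeasurableAtFilter _ _) hY.continuous.continuousAt
  have hstep : Tendsto (fun k : ℕ => 1 / ((k : ℝ) + 1)) atTop (𝓝[>] 0) :=
    tendsto_nhdsWithin_iff.2 ⟨tendsto_one_div_add_atTop_nhds_zero_nat,
      Eventually.of_forall fun k => by have := hpos k; simp only [mem_Ioi]; positivity⟩
  have hlim : Tendsto (fun k => ∫ s in (0 : ℝ)..t, q k s) atTop (𝓝 (Y t - Y 0)) := by
    have h1 := ((hF t).tendsto_slope_zero_right.comp hstep).sub
      ((hF 0).tendsto_slope_zero_right.comp hstep)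
    refine h1.congr fun k => ?_
    have hi : ∀ a b, IntervalIntegrable Y volume a b := fun a b =>
      hY.continuous.intervalIntegrable a b
    have hi' : IntervalIntegrable (fun s => Y (s + 1 / ((k : ℝ) + 1))) volume 0 t :=
      (hY.continuous.comp (by fun_prop :
        Continuous fun s : ℝ => s + 1 / ((k : ℝ) + 1))).intervalIntegrable _ _
    simp only [Function.comp, q, intervalIntegral.integral_smul]
    rw [intervalIntegral.integral_sub hi' (hi _ _), intervalIntegral.integral_comp_add_right,
      ← smul_sub, one_div, inv_inv, intervalIntegral.integral_same, sub_zero, zero_add]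
    -- Both sides equal `∫ Y` over `[h, t + h]` minus `∫ Y` over `[0, t]`, with `h = 1 / (k + 1)`.
    congr 1
    rw [← intervalIntegral.integral_add_adjacent_intervals (hi 0 (((k : ℝ) + 1)⁻¹))
      (hi _ (t + ((k : ℝ) + 1)⁻¹))]
    abel
  rw [← hres]
  refine ext_inner_right ℝ fun w => ?_
  have hfin : μ (Ioc 0 t) ≠ ⊤ := measure_ne_top _ _
  -- Testing the weak limit with `w` on `(0, t]` gives the integral of `g` over `(0, t]`.
  have hw := hg (indicatorConstLp 2 measurableSet_Ioc hfin w) ⟪Y t - Y 0, w⟫ (by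
    refine (hlim.inner tendsto_const_nhds).congr fun k => ?_
    rw [real_inner_comm, real_inner_comm _ ((hmem k).toLp (q k)),
      L2.inner_indicatorConstLp_eq_inner_setIntegral, ← hres]
    congr 1
    exact setIntegral_congr_ae measurableSet_Ioc
      ((hmem k).coeFn_toLp.mono fun s hs _ => hs.symm))
  rw [real_inner_comm, L2.inner_indicatorConstLp_eq_inner_setIntegral] at hw
  rw [← hw, real_inner_comm]

/-- Hilbert spaces have the Radon–Nikodym property: a Lipschitz curve is differentiable almost
everywhere on a half line and is the integral of its derivative. -/
theorem lipschitz_curve_ae_hasDerivAt [CompleteSpace E] {C : NNReal} {Y : ℝ → E}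
    (hY : LipschitzWith C Y) :
    (∀ᵐ t ∂(volume.restrict (Ioi (0 : ℝ))), HasDerivAt Y (deriv Y t) t) ∧
      (∀ t, 0 ≤ t → IntervalIntegrable (deriv Y) volume 0 t) ∧
      ∀ t, 0 ≤ t → Y t = Y 0 + ∫ s in (0 : ℝ)..t, deriv Y s := by
  have key : ∀ T : ℝ, ∃ g : ℝ → E, IntegrableOn g (Ioc 0 T) ∧
      (∀ t ∈ Icc 0 T, Y t - Y 0 = ∫ s in (0 : ℝ)..t, g s) ∧
      ∀ᵐ t : ℝ, t ∈ Ioo 0 T → HasDerivAt Y (g t) t := by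
    intro T
    obtain ⟨g, hgi, hg⟩ := exists_density_of_lipschitz hY T
    refine ⟨g, hgi, hg, ?_⟩
    rcases le_or_gt T 0 with hT | hT
    · refine ae_of_all _ fun t ht => absurd (ht.1.trans ht.2) (not_lt.2 hT)
    have hint : IntervalIntegrable g volume 0 T :=
      (intervalIntegrable_iff_integrableOn_Ioc_of_le hT.le).2 hgi
    filter_upwards [hint.ae_hasDerivAt_integral] with t ht hmem
    rw [uIcc_of_le hT.le] at ht
    have h1 := (ht ⟨hmem.1.le, hmem.2.le⟩ 0 ⟨le_rfl, hT.le⟩).const_add (Y 0)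
    refine h1.congr_of_eventuallyEq ?_
    filter_upwards [Ioo_mem_nhds hmem.1 hmem.2] with s hs
    rw [← hg s ⟨hs.1.le, hs.2.le⟩]
    abel
  have hae : ∀ᵐ t : ℝ, t ∈ Ioi (0 : ℝ) → HasDerivAt Y (deriv Y t) t := by
    choose g _ _ hg using fun k : ℕ => key k
    filter_upwards [ae_all_iff.2 hg] with t ht hpos
    obtain ⟨k, hk⟩ := exists_nat_gt t
    have := ht k ⟨hpos, hk⟩
    rwa [this.deriv]
  have hae' : ∀ T : ℝ, ∃ g : ℝ → E, IntegrableOn g (Ioc 0 T) ∧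
      (∀ t ∈ Icc 0 T, Y t - Y 0 = ∫ s in (0 : ℝ)..t, g s) ∧
      ∀ᵐ t : ℝ, t ∈ Ioc 0 T → deriv Y t = g t := by
    intro T
    obtain ⟨g, h1, h2, h3⟩ := key T
    refine ⟨g, h1, h2, ?_⟩
    -- The endpoint `T` is discarded: there the primitive is only differentiable from the left.
    have hne : ∀ᵐ t : ℝ, t ≠ T := by simp [ae_iff]
    filter_upwards [h3, hne] with t ht hne hmem
    exact (ht ⟨hmem.1, lt_of_le_of_ne hmem.2 hne⟩).deriv
  refine ⟨(ae_restrict_iff' measurableSet_Ioi).2 hae, fun t ht => ?_, fun t ht => ?_⟩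
  · obtain ⟨g, h1, -, h3⟩ := hae' t
    rw [intervalIntegrable_iff_integrableOn_Ioc_of_le ht]
    exact h1.congr ((ae_restrict_iff' measurableSet_Ioc).2 (h3.mono fun s hs hm => (hs hm).symm))
  · obtain ⟨g, h1, h2, h3⟩ := hae' t
    rw [intervalIntegral.integral_congr_ae (g := g) (by rwa [uIoc_of_le ht]),
      ← h2 t ⟨ht, le_rfl⟩]
    abel

/-! ### Absolutely continuous curves -/

/-- A map whose increments are controlled by those of an absolutely continuous function is
absolutely continuous. -/
theorem absolutelyContinuousOnInterval_of_dist_le {X X' : Type*} [PseudoMetricSpace X]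
    [PseudoMetricSpace X'] {N : ℝ → X} {F : ℝ → X'}
    {a b C : ℝ} (hN : AbsolutelyContinuousOnInterval N a b)
    (h : ∀ x ∈ uIcc a b, ∀ y ∈ uIcc a b, dist (F x) (F y) ≤ C * dist (N x) (N y)) :
    AbsolutelyContinuousOnInterval F a b := by
  unfold AbsolutelyContinuousOnInterval at hN ⊢
  have hN' := hN.const_mul C
  rw [mul_zero] at hN'
  refine squeeze_zero' (Eventually.of_forall fun E => Finset.sum_nonneg fun _ _ => dist_nonneg) ?_
    hN'
  have : ∀ᶠ E : ℕ × (ℕ → ℝ × ℝ) in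
      AbsolutelyContinuousOnInterval.totalLengthFilter ⊓
        𝓟 (AbsolutelyContinuousOnInterval.disjWithin a b),
      E ∈ AbsolutelyContinuousOnInterval.disjWithin a b :=
    eventually_inf_principal.2 (Eventually.of_forall fun _ h => h)
  filter_upwards [this] with E hE
  rw [Finset.mul_sum]
  exact Finset.sum_le_sum fun i hi => h _ (hE.1 i hi).1 _ (hE.1 i hi).2

/-- A primitive is differentiable at almost every interior point. -/
theorem ae_hasDerivAt_of_eq_integral [CompleteSpace E] {Y y : ℝ → E}
    (hi : ∀ t, 0 ≤ t → IntervalIntegrable y volume 0 t)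
    (hY : ∀ t, 0 ≤ t → Y t = Y 0 + ∫ s in (0 : ℝ)..t, y s) :
    ∀ᵐ t ∂(volume.restrict (Ioi (0 : ℝ))), HasDerivAt Y (y t) t := by
  rw [ae_restrict_iff' measurableSet_Ioi]
  filter_upwards [ae_all_iff.2 fun k : ℕ => (hi k k.cast_nonneg).ae_hasDerivAt_integral]
    with t ht hpos
  obtain ⟨k, hk⟩ := exists_nat_gt t
  have hk0 : (0 : ℝ) ≤ k := k.cast_nonneg
  have := ht k
  rw [uIcc_of_le hk0] at this
  refine ((this ⟨le_of_lt hpos, hk.le⟩ 0 ⟨le_rfl, hk0⟩).const_add (Y 0)).congr_of_eventuallyEq ?_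
  filter_upwards [Ioi_mem_nhds (show (0 : ℝ) < t from hpos)] with s hs
  exact hY s (le_of_lt hs)

/-- A primitive `W` with `W(0) = 0` and `⟪W', W⟫ ≤ 0` almost everywhere vanishes, since `‖W‖²` is
absolutely continuous and non-increasing. -/
theorem eq_zero_of_inner_deriv_nonpos [CompleteSpace E] {W w : ℝ → E}
    (hi : ∀ t, 0 ≤ t → IntervalIntegrable w volume 0 t)
    (hW : ∀ t, 0 ≤ t → W t = ∫ s in (0 : ℝ)..t, w s)
    (hle : ∀ᵐ t ∂(volume.restrict (Ioi (0 : ℝ))), ⟪w t, W t⟫ ≤ 0) {t : ℝ} (ht : 0 ≤ t) :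
    W t = 0 := by
  have hW0 : W 0 = 0 := by simpa using hW 0 le_rfl
  have hderiv := ae_hasDerivAt_of_eq_integral (Y := W) hi
    (fun t ht => by rw [hW0, zero_add]; exact hW t ht)
  let N : ℝ → ℝ := fun s => ∫ r in (0 : ℝ)..s, ‖w r‖
  have hNac : AbsolutelyContinuousOnInterval N 0 t :=
    (hi t ht).norm.absolutelyContinuousOnInterval_intervalIntegral (by simp)
  have hdist : ∀ x ∈ uIcc 0 t, ∀ y ∈ uIcc 0 t, dist (W x) (W y) ≤ 1 * dist (N x) (N y) := by
    intro x hx y hy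
    rw [uIcc_of_le ht] at hx hy
    rw [hW x hx.1, hW y hy.1, one_mul, dist_eq_norm, Real.dist_eq,
      intervalIntegral.integral_interval_sub_left (hi x hx.1) (hi y hy.1),
      intervalIntegral.integral_interval_sub_left (hi x hx.1).norm (hi y hy.1).norm]
    exact intervalIntegral.norm_integral_le_abs_integral_norm
  have hWac := absolutelyContinuousOnInterval_of_dist_le hNac hdist
  obtain ⟨R, hR⟩ := hWac.exists_bound
  have hsq : AbsolutelyContinuousOnInterval (fun s => ‖W s‖ ^ 2) 0 t := by
    refine absolutelyContinuousOnInterval_of_dist_le (C := 2 * R) hWac fun x hx y hy => ?_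
    have h1 := hR x hx
    have h2 := hR y hy
    have h3 := abs_norm_sub_norm_le (W x) (W y)
    rw [Real.dist_eq, dist_eq_norm, sq_sub_sq, abs_mul, abs_of_nonneg (by positivity)]
    exact mul_le_mul (by linarith) h3 (abs_nonneg _) (by linarith [norm_nonneg (W x)])
  have hint := hsq.integral_deriv_eq_sub
  have hneg : ∫ s in (0 : ℝ)..t, deriv (fun s => ‖W s‖ ^ 2) s ≤ 0 := by
    rw [intervalIntegral.integral_of_le ht]
    refine integral_nonpos_of_ae ?_
    have hr : volume.restrict (Ioc 0 t) ≤ volume.restrict (Ioi (0 : ℝ)) :=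
      Measure.restrict_mono Ioc_subset_Ioi_self le_rfl
    filter_upwards [hr.absolutelyContinuous.ae_le hderiv, hr.absolutelyContinuous.ae_le hle]
      with s hs hs'
    rw [hs.norm_sq.deriv, real_inner_comm]
    simpa only [Pi.zero_apply] using mul_nonpos_of_nonneg_of_nonpos zero_le_two hs'
  rw [hint, hW0] at hneg
  have : ‖W t‖ ^ 2 ≤ 0 := by simpa using hneg
  simpa using this

end Hilbert

section Projection

variable {E : Type*} [NormedAddCommGroup E] [InnerProductSpace ℝ E] {K : Set E} {P : E → E}

/-! ### Projections onto closed convex sets -/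

/-- `P` is the metric projection onto the convex set `K`, in the variational characterization. -/
structure IsMetricProjection (K : Set E) (P : E → E) : Prop where
  mem : ∀ x, P x ∈ K
  inner_le : ∀ x, ∀ w ∈ K, ⟪x - P x, w - P x⟫ ≤ 0

theorem exists_isMetricProjection [CompleteSpace E] (hne : K.Nonempty) (hcl : IsClosed K)
    (hcv : Convex ℝ K) : ∃ P : E → E, IsMetricProjection K P := by
  choose P hP hmin using exists_norm_eq_iInf_of_complete_convex hne hcl.isComplete hcv
  exact ⟨P, hP, fun x => (norm_eq_iInf_iff_real_inner_le_zero hcv (hP x)).1 (hmin x)⟩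

namespace IsMetricProjection

theorem norm_sub_le (hP : IsMetricProjection K P) (x y : E) : ‖P x - P y‖ ≤ ‖x - y‖ := by
  have h1 := hP.inner_le x (P y) (hP.mem y)
  have h2 := hP.inner_le y (P x) (hP.mem x)
  have h3 : ‖P x - P y‖ ^ 2 ≤ ⟪x - y, P x - P y⟫ := by
    rw [← real_inner_self_eq_norm_sq]
    simp only [inner_sub_left, inner_sub_right] at h1 h2 ⊢
    linarith
  have h4 := real_inner_le_norm (x - y) (P x - P y)
  by_contra! hlt
  nlinarith [norm_nonneg (x - y)]

theorem eq_of_inner_le (hP : IsMetricProjection K P) {x p : E} (hp : p ∈ K)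
    (h : ∀ w ∈ K, ⟪x - p, w - p⟫ ≤ 0) : P x = p := by
  have h1 := hP.inner_le x p hp
  have h2 := h (P x) (hP.mem x)
  have h3 : ‖P x - p‖ ^ 2 ≤ 0 := by
    rw [← real_inner_self_eq_norm_sq]
    simp only [inner_sub_left, inner_sub_right] at h1 h2 ⊢
    linarith
  have h4 : ‖P x - p‖ = 0 := by nlinarith [norm_nonneg (P x - p)]
  exact sub_eq_zero.1 (norm_eq_zero.1 h4)

theorem eq_self (hP : IsMetricProjection K P) {x : E} (hx : x ∈ K) : P x = x :=
  hP.eq_of_inner_le hx fun w _ => by simp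

/-- The projection commutes with every isometry that maps `K` onto itself. -/
theorem map_comm (hP : IsMetricProjection K P) (U V : E →ₗᵢ[ℝ] E) (hUV : ∀ x, U (V x) = x)
    (hU : ∀ x ∈ K, U x ∈ K) (hV : ∀ x ∈ K, V x ∈ K) (x : E) : P (U x) = U (P x) := by
  refine hP.eq_of_inner_le (hU _ (hP.mem x)) fun w hw => ?_
  have h := hP.inner_le x (V w) (hV w hw)
  rwa [← U.inner_map_map, map_sub, map_sub, hUV] at h

end IsMetricProjection

end Projection

/-! ### One-parameter groups of isometries -/

/-- A one-parameter group of linear isometries. Strong continuity is not part of the structure. -/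
structure IsometryGroup (E : Type*) [NormedAddCommGroup E] [InnerProductSpace ℝ E] where
  /-- The isometry at time `r`. -/
  map : ℝ → E →ₗᵢ[ℝ] E
  map_zero' : ∀ x, map 0 x = x
  map_add' : ∀ r s x, map (r + s) x = map r (map s x)

namespace IsometryGroup

variable {E : Type*} [NormedAddCommGroup E] [InnerProductSpace ℝ E] (U : IsometryGroup E)

theorem map_map_neg (r : ℝ) (x : E) : U.map r (U.map (-r) x) = x := by
  rw [← U.map_add', add_neg_cancel, U.map_zero']

theorem inner_map_left (r : ℝ) (x y : E) : ⟪U.map r x, y⟫ = ⟪x, U.map (-r) y⟫ := by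
  rw [← (U.map r).inner_map_map x, U.map_map_neg]

theorem norm_map_sub (r : ℝ) (x y : E) : ‖U.map r x - y‖ = ‖x - U.map (-r) y‖ := by
  rw [← (U.map r).norm_map (x - _), map_sub, U.map_map_neg]

theorem hasDerivAt_of_zero {x x' : E} (h : HasDerivAt (fun r => U.map r x) x' 0) (r : ℝ) :
    HasDerivAt (fun r => U.map r x) (U.map r x') r := by
  have h0 : HasDerivAt (fun s => U.map s x) x' (r - r) := by rwa [sub_self]
  have h1 := (h0.comp_sub_const r r)
  have h2 := (U.map r).toContinuousLinearMap.hasFDerivAt.comp_hasDerivAt r h1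
  refine h2.congr_of_eventuallyEq (Eventually.of_forall fun s => ?_)
  simp [← U.map_add']

/-- The generator of a group of isometries is skew-symmetric. -/
theorem inner_generator {x x' y y' : E} (hx : HasDerivAt (fun r => U.map r x) x' 0)
    (hy : HasDerivAt (fun r => U.map r y) y' 0) : ⟪x, y'⟫ = -⟪x', y⟫ := by
  have h1 := hx.inner ℝ hy
  have h2 : HasDerivAt (fun r : ℝ => ⟪U.map r x, U.map r y⟫) 0 0 := by
    simpa using hasDerivAt_const (0 : ℝ) ⟪x, y⟫
  have h3 := h1.unique h2
  simp only [U.map_zero'] at h3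
  linarith

theorem norm_map_sub_self_le {x x' : E} (hx : HasDerivAt (fun r => U.map r x) x' 0) (r : ℝ) :
    ‖U.map r x - x‖ ≤ ‖x'‖ * |r| := by
  have h := Convex.norm_image_sub_le_of_norm_hasDerivWithin_le (s := univ) (x := 0) (y := r)
    (C := ‖x'‖)
    (fun s _ => (U.hasDerivAt_of_zero hx s).hasDerivWithinAt) (fun s _ => by simp) convex_univ
    (mem_univ _) (mem_univ _)
  simpa [U.map_zero'] using h

theorem continuous_of_dense {D : Set E} (hD : Dense D)
    (h : ∀ x ∈ D, ContinuousAt (fun r => U.map r x) 0) (x : E) :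
    Continuous fun r => U.map r x := by
  have h0 : Tendsto (fun r => U.map r x) (𝓝 0) (𝓝 x) := by
    rw [Metric.tendsto_nhds]
    intro ε hε
    obtain ⟨y, hy, hxy⟩ := hD.exists_dist_lt x (show 0 < ε / 3 by positivity)
    have h1 := h y hy
    rw [ContinuousAt, U.map_zero', Metric.tendsto_nhds] at h1
    filter_upwards [h1 (ε / 3) (by positivity)] with r hr
    calc dist (U.map r x) x ≤ dist (U.map r x) (U.map r y) + dist (U.map r y) y + dist y x :=
          dist_triangle4 _ _ _ _
      _ < ε / 3 + ε / 3 + ε / 3 := by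
          rw [(U.map r).dist_map, dist_comm y x]
          gcongr
      _ = ε := by ring
  refine continuous_iff_continuousAt.2 fun r => ?_
  have h1 : Tendsto (fun s => s - r) (𝓝 r) (𝓝 0) := by
    have : Continuous fun s : ℝ => s - r := by fun_prop
    simpa using this.tendsto r
  have h2 := ((U.map r).continuous.tendsto x).comp (h0.comp h1)
  refine h2.congr fun s => ?_
  simp [← U.map_add']

/-- Identification of the generator by duality: if `⟪x, A φ⟫ = -⟪x', φ⟫` along the orbits of a
dense set of differentiable vectors `φ`, where `A` is the generator, then `x' = A x`. -/
theorem hasDerivAt_of_dense [CompleteSpace E] {D : Set E} (hD : Dense D) {x x' : E}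
    (h : ∀ φ ∈ D, ∃ φ', HasDerivAt (fun r => U.map r φ) φ' 0 ∧
      ∀ r, ⟪x, U.map r φ'⟫ = -⟪x', U.map r φ⟫) :
    HasDerivAt (fun r => U.map r x) x' 0 := by
  have hc := U.continuous_of_dense hD (fun φ hφ => by
    obtain ⟨φ', h1, -⟩ := h φ hφ
    exact h1.continuousAt) x'
  have hI : ∀ t, HasDerivAt (fun t => ∫ r in (0 : ℝ)..t, U.map r x') (U.map t x') t := fun t =>
    intervalIntegral.integral_hasDerivAt_right (hc.intervalIntegrable _ _)
      (hc.stronglyMeasurableAtFilter _ _) hc.continuousAt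
  have heq : ∀ t, U.map t x = x + ∫ r in (0 : ℝ)..t, U.map r x' := by
    intro t
    refine hD.eq_of_inner_left ℝ fun φ hφ => ?_
    obtain ⟨φ', h1, h2⟩ := h φ hφ
    have hd : ∀ s, HasDerivAt
        (fun s => ⟪U.map s x, φ⟫ - ⟪∫ r in (0 : ℝ)..s, U.map r x', φ⟫) 0 s := by
      intro s
      have h3 := (U.hasDerivAt_of_zero h1 (-s)).scomp s (hasDerivAt_neg s)
      have h4 := (hasDerivAt_const s x).inner ℝ h3
      have h5 := (hI s).inner ℝ (hasDerivAt_const s φ)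
      have h6 := h4.fun_sub h5
      simp only [Function.comp_def, inner_zero_left, inner_zero_right, neg_smul, one_smul,
        inner_neg_right, add_zero, zero_add, U.inner_map_left, h2, neg_neg, sub_self] at h6
      simpa only [U.inner_map_left] using h6
    have h0 := is_const_of_deriv_eq_zero (fun s => (hd s).differentiableAt)
      (fun s => (hd s).deriv) t 0
    simp only [U.map_zero', intervalIntegral.integral_same, inner_zero_left, sub_zero] at h0
    rw [inner_add_left, ← h0]
    ring
  have h7 := (hI 0).const_add x
  rw [U.map_zero'] at h7
  exact h7.congr_of_eventuallyEq (Eventually.of_forall heq)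

end IsometryGroup

section Generator

variable {E : Type*} [NormedAddCommGroup E] [InnerProductSpace ℝ E] (U : IsometryGroup E)

/-- The same group run backwards in time. -/
def IsometryGroup.reverse : IsometryGroup E where
  map r := U.map (-r)
  map_zero' x := by rw [neg_zero, U.map_zero']
  map_add' r s x := by rw [neg_add, U.map_add']

theorem IsometryGroup.hasDerivAt_reverse {x x' : E} (h : HasDerivAt (fun r => U.map r x) x' 0) :
    HasDerivAt (fun r => U.reverse.map r x) (-x') 0 := by
  have h' : HasDerivAt (fun r => U.map r x) x' (-0) := by rwa [neg_zero]
  have := h'.scomp (0 : ℝ) (hasDerivAt_neg 0)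
  simpa [Function.comp_def, IsometryGroup.reverse] using this

/-- An orbit that is Lipschitz at time zero is differentiable, provided that the differentiable
vectors are dense: the derivative is a weak limit of difference quotients. -/
theorem IsometryGroup.exists_hasDerivAt_of_lipschitz [CompleteSpace E]
    (hD : Dense {φ | ∃ φ', HasDerivAt (fun r => U.map r φ) φ' 0}) {x : E} {M : ℝ}
    (hx : ∀ r, ‖U.map r x - x‖ ≤ M * |r|) :
    ∃ x', ‖x'‖ ≤ M ∧ HasDerivAt (fun r => U.map r x) x' 0 := by
  have hpos : ∀ k : ℕ, (0 : ℝ) < (k : ℝ) + 1 := fun k => by positivity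
  have hlim0 : Tendsto (fun k : ℕ => -(1 / ((k : ℝ) + 1))) atTop (𝓝[≠] 0) := by
    refine tendsto_nhdsWithin_iff.2 ⟨?_, Eventually.of_forall fun k => ?_⟩
    · simpa using (tendsto_one_div_add_atTop_nhds_zero_nat (𝕜 := ℝ)).neg
    · have := hpos k
      exact neg_ne_zero.2 (by positivity)
  obtain ⟨x', hx', hw⟩ := exists_weak_limit
    (fun k : ℕ => ((k : ℝ) + 1) • (U.map (1 / ((k : ℝ) + 1)) x - x)) (M := M) (fun k => by
      rw [norm_smul, Real.norm_of_nonneg (hpos k).le]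
      have h1 := hx (1 / ((k : ℝ) + 1))
      rw [abs_of_pos (by have := hpos k; positivity)] at h1
      calc ((k : ℝ) + 1) * ‖U.map (1 / ((k : ℝ) + 1)) x - x‖
          ≤ ((k : ℝ) + 1) * (M * (1 / ((k : ℝ) + 1))) := by
            have := hpos k
            gcongr
        _ = M := by have := (hpos k).ne'; field_simp)
  have hdual : ∀ φ φ', HasDerivAt (fun r => U.map r φ) φ' 0 → ⟪x, φ'⟫ = -⟪x', φ⟫ := by
    intro φ φ' hφ
    rw [hw φ (-⟪x, φ'⟫), neg_neg]
    have h1 := ((hφ.tendsto_slope_zero.comp hlim0).inner (𝕜 := ℝ) (tendsto_const_nhds (x := x))).neg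
    rw [real_inner_comm x φ'] at h1
    refine h1.congr fun k => ?_
    simp only [Function.comp, zero_add, U.map_zero']
    rw [inner_smul_left, inner_smul_left, inner_sub_left, inner_sub_left, U.inner_map_left _ φ,
      neg_neg, real_inner_comm _ φ, real_inner_comm x φ]
    simp only [one_div, inv_neg, inv_inv, conj_trivial]
    ring
  refine ⟨x', hx', U.hasDerivAt_of_dense hD fun φ ⟨φ', hφ⟩ => ⟨φ', hφ, fun r => hdual _ _ ?_⟩⟩
  refine ((U.map r).toContinuousLinearMap.hasFDerivAt.comp_hasDerivAt 0 hφ).congr_of_eventuallyEq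
    (Eventually.of_forall fun s => ?_)
  simp [← U.map_add', add_comm]

end Generator

section Splitting

variable {E : Type*} [NormedAddCommGroup E] [InnerProductSpace ℝ E]

/-! ### The splitting scheme -/

/-- One step of the splitting scheme: transport during time `h`, then projection. -/
noncomputable def splitStep (P : E → E) (U : IsometryGroup E) (h : ℝ) (x : E) : E := P (U.map h x)

/-- The approximation at time `t` obtained from `⌊2ᵐ t⌋` splitting steps of length `2⁻ᵐ`. -/
noncomputable def splitApprox (P : E → E) (U : IsometryGroup E) (x₀ : E) (m : ℕ) (t : ℝ) : E :=
  (splitStep P U ((2 : ℝ) ^ m)⁻¹)^[⌊t * 2 ^ m⌋₊] x₀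

/-- A closed set `D` of regular data, stable under transport and under projection, on which
transport is Lipschitz in time with constant `C`. -/
structure IsRegularClass (P : E → E) (U : IsometryGroup E) (D : Set E) (C : NNReal) : Prop where
  isClosed : IsClosed D
  map_mem : ∀ r, ∀ x ∈ D, U.map r x ∈ D
  proj_mem : ∀ x ∈ D, P x ∈ D
  norm_le : ∀ r, ∀ x ∈ D, ‖U.map r x - x‖ ≤ C * |r|

variable {K D : Set E} {P : E → E} {U : IsometryGroup E} {C : NNReal} {x₀ : E}

theorem iterate_splitStep_mem (hP : IsMetricProjection K P) (hD : IsRegularClass P U D C)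
    (h : ℝ) {x : E} (hx : x ∈ K) (hx' : x ∈ D) (k : ℕ) :
    (splitStep P U h)^[k] x ∈ K ∧ (splitStep P U h)^[k] x ∈ D := by
  induction k with
  | zero => exact ⟨hx, hx'⟩
  | succ k ih =>
    rw [Function.iterate_succ_apply']
    exact ⟨hP.mem _, hD.proj_mem _ (hD.map_mem _ _ ih.2)⟩

theorem norm_splitStep_sub_le (hP : IsMetricProjection K P) (hD : IsRegularClass P U D C)
    {h : ℝ} (hh : 0 ≤ h) {x : E} (hx : x ∈ K) (hx' : x ∈ D) :
    ‖splitStep P U h x - x‖ ≤ C * h := by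
  have h1 := hP.norm_sub_le (U.map h x) x
  rw [hP.eq_self hx] at h1
  have h2 := hD.norm_le h x hx'
  rw [abs_of_nonneg hh] at h2
  exact h1.trans h2

theorem norm_iterate_splitStep_sub_le (hP : IsMetricProjection K P) (hD : IsRegularClass P U D C)
    {h : ℝ} (hh : 0 ≤ h) {x : E} (hx : x ∈ K) (hx' : x ∈ D) (i j : ℕ) :
    ‖(splitStep P U h)^[i + j] x - (splitStep P U h)^[i] x‖ ≤ C * (j * h) := by
  induction j with
  | zero => simp
  | succ j ih =>
    obtain ⟨h1, h2⟩ := iterate_splitStep_mem hP hD h hx hx' (i + j)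
    have h3 := norm_splitStep_sub_le hP hD hh h1 h2
    rw [← add_assoc, Function.iterate_succ_apply']
    have h4 := norm_sub_le_norm_sub_add_norm_sub (splitStep P U h ((splitStep P U h)^[i + j] x))
      ((splitStep P U h)^[i + j] x) ((splitStep P U h)^[i] x)
    push_cast
    linarith

/-- One long step against two short ones. Writing `z` for the normal vector removed by the
intermediate projection, the square of the distance grows by at most
`2 ‖U_h a - a‖ ‖z‖ - ‖z‖² ≤ (C h)²`, because `⟪z, a - p⟫ ≤ 0` at the projected point `p`. -/
theorem sq_norm_splitStep_sub_le (hP : IsMetricProjection K P) (hD : IsRegularClass P U D C)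
    {h : ℝ} (hh : 0 ≤ h) {a : E} (ha : a ∈ K) (ha' : a ∈ D) (c : E) :
    ‖splitStep P U (2 * h) a - splitStep P U h (splitStep P U h c)‖ ^ 2
      ≤ ‖a - c‖ ^ 2 + (C * h) ^ 2 := by
  set p := splitStep P U h c with hp
  set z := U.map h c - p with hz
  have h1 : ‖splitStep P U (2 * h) a - splitStep P U h p‖ ≤ ‖U.map h a - p‖ := by
    refine (hP.norm_sub_le _ _).trans_eq ?_
    rw [two_mul, U.map_add', ← map_sub, (U.map h).norm_map]
  have h2 : ⟪z, a - p⟫ ≤ 0 := hP.inner_le (U.map h c) a ha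
  have h3 : ‖a - c‖ ^ 2 = ‖U.map h a - p‖ ^ 2 - 2 * ⟪U.map h a - p, z⟫ + ‖z‖ ^ 2 := by
    rw [← (U.map h).norm_map, map_sub, ← norm_sub_sq_real, hz, sub_sub_sub_cancel_right]
  have h4 : ⟪U.map h a - p, z⟫ = ⟪U.map h a - a, z⟫ + ⟪z, a - p⟫ := by
    rw [real_inner_comm (a - p) z, ← inner_add_left, sub_add_sub_cancel]
  have h5 := real_inner_le_norm (U.map h a - a) z
  have h6 : ‖U.map h a - a‖ ≤ C * h := by simpa only [abs_of_nonneg hh] using hD.norm_le h a ha'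
  have h7 : ‖U.map h a - a‖ * ‖z‖ ≤ C * h * ‖z‖ := by gcongr
  have h8 : ‖splitStep P U (2 * h) a - splitStep P U h p‖ ^ 2 ≤ ‖U.map h a - p‖ ^ 2 := by gcongr
  nlinarith [sq_nonneg (C * h - ‖z‖)]

theorem sq_norm_iterate_splitStep_sub_le (hP : IsMetricProjection K P)
    (hD : IsRegularClass P U D C) {h : ℝ} (hh : 0 ≤ h) {x : E} (hx : x ∈ K) (hx' : x ∈ D) (k : ℕ) :
    ‖(splitStep P U (2 * h))^[k] x - (splitStep P U h)^[2 * k] x‖ ^ 2 ≤ k * (C * h) ^ 2 := by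
  induction k with
  | zero => simp
  | succ k ih =>
    obtain ⟨h1, h2⟩ := iterate_splitStep_mem hP hD (2 * h) hx hx' k
    have h3 := sq_norm_splitStep_sub_le hP hD hh h1 h2 ((splitStep P U h)^[2 * k] x)
    rw [show 2 * (k + 1) = 2 * k + 1 + 1 by ring, Function.iterate_succ_apply',
      Function.iterate_succ_apply', Function.iterate_succ_apply']
    push_cast
    linarith

/-- With `k` steps of length `2⁻ᵐ` up to time `t`, the refined scheme makes `2k` or `2k + 1` steps
of half that length; the first `2k` cost `√(k (C h)²)` and the possible last one `C h`. -/
theorem norm_splitApprox_succ_sub_le (hP : IsMetricProjection K P) (hD : IsRegularClass P U D C)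
    (hx : x₀ ∈ K) (hx' : x₀ ∈ D) (m : ℕ) (t : ℝ) :
    ‖splitApprox P U x₀ m t - splitApprox P U x₀ (m + 1) t‖
      ≤ C * (√|t| + 1) * (√(2⁻¹)) ^ m := by
  set N : ℝ := 2 ^ m with hN
  have hNpos : 0 < N := by positivity
  set k := ⌊t * N⌋₊ with hk
  set h : ℝ := ((2 : ℝ) ^ (m + 1))⁻¹ with hh
  have hhpos : 0 < h := by positivity
  have h2h : N⁻¹ = 2 * h := by rw [hh, hN, pow_succ]; field_simp
  -- For `t < 0` both floors vanish.
  obtain ⟨e, he, hke⟩ : ∃ e : ℕ, e ≤ 1 ∧ ⌊t * 2 ^ (m + 1)⌋₊ = 2 * k + e := by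
    have h1 : 2 * k ≤ ⌊t * 2 ^ (m + 1)⌋₊ := by
      rcases le_or_gt 0 t with ht | ht
      · refine Nat.le_floor ?_
        have := Nat.floor_le (show 0 ≤ t * N by positivity)
        push_cast
        rw [pow_succ]
        linarith
      · have : k = 0 := Nat.floor_of_nonpos (mul_nonpos_of_nonpos_of_nonneg ht.le hNpos.le)
        simp [this]
    have h2 : ⌊t * 2 ^ (m + 1)⌋₊ < 2 * k + 2 := by
      refine (Nat.floor_lt' (by omega)).2 ?_
      have := Nat.lt_floor_add_one (t * N)
      push_cast
      rw [pow_succ]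
      linarith
    exact ⟨⌊t * 2 ^ (m + 1)⌋₊ - 2 * k, by omega, by omega⟩
  have hkh : k * (2 * h) ≤ |t| := by
    rw [← h2h, mul_inv_le_iff₀ hNpos]
    rcases le_or_gt 0 t with ht | ht
    · rw [abs_of_nonneg ht]
      exact Nat.floor_le (by positivity)
    · have : k = 0 := Nat.floor_of_nonpos (mul_nonpos_of_nonpos_of_nonneg ht.le hNpos.le)
      rw [this, Nat.cast_zero]
      positivity
  have hq : √(2⁻¹) ^ m * √(2⁻¹) ^ m = 2 * h := by
    rw [← mul_pow, Real.mul_self_sqrt (by norm_num), ← h2h, hN, inv_pow]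
  have hq1 : √(2⁻¹) ^ m ≤ 1 := pow_le_one₀ (Real.sqrt_nonneg _) (Real.sqrt_le_one.2 (by norm_num))
  have hq0 : 0 ≤ √(2⁻¹ : ℝ) ^ m := by positivity
  have hhq : h ≤ √(2⁻¹) ^ m := by nlinarith
  have h1 := sq_norm_iterate_splitStep_sub_le hP hD hhpos.le hx hx' k
  have h2 := norm_iterate_splitStep_sub_le hP hD hhpos.le hx hx' (2 * k) e
  have h3 : ‖(splitStep P U (2 * h))^[k] x₀ - (splitStep P U h)^[2 * k] x₀‖
      ≤ C * √|t| * √(2⁻¹) ^ m := by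
    refine abs_le_of_sq_le_sq' (h1.trans ?_) (by positivity) |>.2
    have h4 : (C * √|t| * √(2⁻¹) ^ m) ^ 2 = C ^ 2 * (√|t| * √|t|) * (√(2⁻¹) ^ m * √(2⁻¹) ^ m) := by
      ring
    rw [h4, hq, Real.mul_self_sqrt (abs_nonneg t)]
    have h5 : C ^ 2 * (k * (2 * h)) * (2 * h) ≤ (C : ℝ) ^ 2 * |t| * (2 * h) := by gcongr
    have h6 : 0 ≤ (C : ℝ) ^ 2 * k * h ^ 2 := by positivity
    nlinarith
  have h4 : ‖(splitStep P U h)^[2 * k + e] x₀ - (splitStep P U h)^[2 * k] x₀‖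
      ≤ C * √(2⁻¹) ^ m := by
    refine h2.trans ?_
    have : (e : ℝ) ≤ 1 := by exact_mod_cast he
    gcongr
    nlinarith
  have h5 : splitApprox P U x₀ m t = (splitStep P U (2 * h))^[k] x₀ := by
    rw [splitApprox, ← hN, h2h]
  have h6 : splitApprox P U x₀ (m + 1) t = (splitStep P U h)^[2 * k + e] x₀ := by
    rw [splitApprox, hke]
  rw [h5, h6]
  have h7 := norm_sub_le_norm_sub_add_norm_sub ((splitStep P U (2 * h))^[k] x₀)
    ((splitStep P U h)^[2 * k] x₀) ((splitStep P U h)^[2 * k + e] x₀)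
  rw [norm_sub_rev ((splitStep P U h)^[2 * k] x₀)] at h7
  linarith

theorem cauchySeq_splitApprox (hP : IsMetricProjection K P) (hD : IsRegularClass P U D C)
    (hx : x₀ ∈ K) (hx' : x₀ ∈ D) (t : ℝ) : CauchySeq fun m => splitApprox P U x₀ m t := by
  refine cauchySeq_of_le_geometric (√(2⁻¹)) (C * (√|t| + 1)) ?_ fun m => ?_
  · exact (Real.sqrt_lt' one_pos).2 (by norm_num)
  · rw [dist_eq_norm]
    exact norm_splitApprox_succ_sub_le hP hD hx hx' m t

theorem norm_splitApprox_sub_le (hP : IsMetricProjection K P) (hD : IsRegularClass P U D C)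
    (hx : x₀ ∈ K) (hx' : x₀ ∈ D) (m : ℕ) {s t : ℝ} (hst : s ≤ t) :
    ‖splitApprox P U x₀ m t - splitApprox P U x₀ m s‖ ≤ C * (t - s + ((2 : ℝ) ^ m)⁻¹) := by
  set N : ℝ := 2 ^ m with hN
  have hNpos : 0 < N := by positivity
  obtain ⟨j, hj⟩ := Nat.exists_eq_add_of_le (Nat.floor_le_floor (show s * N ≤ t * N by gcongr))
  have h1 := norm_iterate_splitStep_sub_le hP hD (inv_pos.2 hNpos).le hx hx' ⌊s * N⌋₊ j
  have h2 : (j : ℝ) ≤ (t - s) * N + 1 := by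
    rcases le_or_gt 0 t with ht | ht
    · have h3 := Nat.floor_le (show 0 ≤ t * N by positivity)
      have h4 := Nat.lt_floor_add_one (s * N)
      rw [hj] at h3
      push_cast at h3
      linarith
    · have : ⌊t * N⌋₊ = 0 := Nat.floor_of_nonpos (mul_nonpos_of_nonpos_of_nonneg ht.le hNpos.le)
      have h5 : j = 0 := by omega
      have := mul_nonneg (sub_nonneg.2 hst) hNpos.le
      rw [h5, Nat.cast_zero]
      linarith
  rw [splitApprox, splitApprox, ← hN, hj]
  refine h1.trans ?_
  gcongr
  calc (j : ℝ) * N⁻¹ ≤ ((t - s) * N + 1) * N⁻¹ := by gcongr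
    _ = t - s + N⁻¹ := by field_simp

/-- The discrete evolution variational inequality, summed over `j` steps. A single step gives
`‖P (U_h y) - w‖ ≤ ‖y - U_{-h} w‖`, and `y` stays within `C J h` of the starting point. -/
theorem sq_norm_iterate_splitStep_sub_le_add (hP : IsMetricProjection K P)
    (hD : IsRegularClass P U D C) {h : ℝ} (hh : 0 ≤ h) {x : E} (hx : x ∈ K) (hx' : x ∈ D)
    {w : E} (hw : w ∈ K) (i j J : ℕ) (hjJ : j ≤ J) :
    ‖(splitStep P U h)^[i + j] x - w‖ ^ 2 ≤ ‖(splitStep P U h)^[i] x - w‖ ^ 2 +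
      j * (2 * ⟪(splitStep P U h)^[i] x - w, w - U.map (-h) w⟫
        + 2 * (C * (J * h)) * ‖w - U.map (-h) w‖ + ‖w - U.map (-h) w‖ ^ 2) := by
  set d := w - U.map (-h) w with hd
  induction j with
  | zero => simp
  | succ j ih =>
    have ih := ih (by omega)
    set y := (splitStep P U h)^[i + j] x with hy
    have h1 : ‖splitStep P U h y - w‖ ≤ ‖(y - w) + d‖ := by
      have h2 := hP.norm_sub_le (U.map h y) w
      rw [hP.eq_self hw, U.norm_map_sub] at h2
      rwa [hd, sub_add_sub_cancel]
    have h2 : ‖splitStep P U h y - w‖ ^ 2 ≤ ‖y - w‖ ^ 2 + 2 * ⟪y - w, d⟫ + ‖d‖ ^ 2 := by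
      rw [← norm_add_sq_real]
      gcongr
    have h3 : ⟪y - w, d⟫ ≤ ⟪(splitStep P U h)^[i] x - w, d⟫ + C * (J * h) * ‖d‖ := by
      have h4 : ⟪y - w, d⟫ = ⟪(splitStep P U h)^[i] x - w, d⟫
          + ⟪y - (splitStep P U h)^[i] x, d⟫ := by
        rw [← inner_add_left, add_comm, sub_add_sub_cancel]
      have h5 := real_inner_le_norm (y - (splitStep P U h)^[i] x) d
      have h6 : ‖y - (splitStep P U h)^[i] x‖ ≤ C * (J * h) := by
        refine (norm_iterate_splitStep_sub_le hP hD hh hx hx' i j).trans ?_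
        have : (j : ℝ) ≤ J := by exact_mod_cast (by omega : j ≤ J)
        gcongr
      have h7 : ‖y - (splitStep P U h)^[i] x‖ * ‖d‖ ≤ C * (J * h) * ‖d‖ := by gcongr
      linarith
    rw [← add_assoc, Function.iterate_succ_apply', ← hy]
    push_cast
    linarith

/-- Pointwise limit of the splitting scheme: a Lipschitz curve in `K ∩ D` that satisfies the
evolution variational inequality wherever it is differentiable. -/
theorem exists_splitting_limit [CompleteSpace E] (hK : IsClosed K) (hP : IsMetricProjection K P)
    (hD : IsRegularClass P U D C) (hx : x₀ ∈ K) (hx' : x₀ ∈ D) :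
    ∃ Y : ℝ → E, Y 0 = x₀ ∧ LipschitzWith C Y ∧ (∀ t, Y t ∈ K ∧ Y t ∈ D) ∧
      ∀ w ∈ K, ∀ b, HasDerivAt (fun r => U.map r w) (-b) 0 →
        ∀ s, 0 ≤ s → ∀ y, HasDerivAt Y y s → ⟪y, Y s - w⟫ ≤ -⟪b, Y s - w⟫ := by
  choose Y hY using fun t => cauchySeq_tendsto_of_complete (cauchySeq_splitApprox hP hD hx hx' t)
  have hN : Tendsto (fun m : ℕ => (2 : ℝ) ^ m) atTop atTop :=
    tendsto_pow_atTop_atTop_of_one_lt one_lt_two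
  have hh : Tendsto (fun m : ℕ => ((2 : ℝ) ^ m)⁻¹) atTop (𝓝 0) := tendsto_inv_atTop_zero.comp hN
  have hLip : ∀ s t, s ≤ t → ‖Y t - Y s‖ ≤ C * (t - s) := by
    intro s t hst
    have h1 := ((hh.const_add (t - s)).const_mul (C : ℝ))
    rw [add_zero] at h1
    exact le_of_tendsto_of_tendsto' ((hY t).sub (hY s)).norm h1
      fun m => norm_splitApprox_sub_le hP hD hx hx' m hst
  refine ⟨Y, ?_, LipschitzWith.of_dist_le_mul fun t s => ?_, fun t => ⟨?_, ?_⟩, ?_⟩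
  · refine tendsto_nhds_unique (hY 0) ?_
    simp [splitApprox]
  · rw [dist_eq_norm, Real.dist_eq]
    rcases le_total s t with hst | hst
    · rw [abs_of_nonneg (sub_nonneg.2 hst)]
      exact hLip s t hst
    · rw [norm_sub_rev, abs_sub_comm, abs_of_nonneg (sub_nonneg.2 hst)]
      exact hLip t s hst
  · exact hK.mem_of_tendsto (hY t)
      (Eventually.of_forall fun m => (iterate_splitStep_mem hP hD _ hx hx' _).1)
  · exact hD.isClosed.mem_of_tendsto (hY t)
      (Eventually.of_forall fun m => (iterate_splitStep_mem hP hD _ hx hx' _).2)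
  intro w hw b hb s hs y hy
  -- The difference quotient of the transported competitor along the step sizes of the scheme.
  have hquot : Tendsto (fun m : ℕ => (2 : ℝ) ^ m • (w - U.map (-((2 : ℝ) ^ m)⁻¹) w)) atTop
      (𝓝 (-b)) := by
    have h1 : Tendsto (fun m : ℕ => -((2 : ℝ) ^ m)⁻¹) atTop (𝓝[≠] 0) := by
      refine tendsto_nhdsWithin_iff.2 ⟨by simpa using hh.neg, Eventually.of_forall fun m => ?_⟩
      simp
    refine (hb.tendsto_slope_zero.comp h1).congr fun m => ?_
    simp only [Function.comp, zero_add, U.map_zero', inv_neg, inv_inv, neg_smul, ← smul_neg,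
      neg_sub]
  have hfloor : ∀ t, 0 ≤ t → Tendsto (fun m : ℕ => (⌊t * 2 ^ m⌋₊ : ℝ) * ((2 : ℝ) ^ m)⁻¹) atTop
      (𝓝 t) := fun t ht =>
    ((tendsto_nat_floor_mul_div_atTop ht).comp hN).congr fun m => by
      simp only [Function.comp, div_eq_mul_inv]
  -- The discrete inequality in the limit; the error term is quadratic in `t - s`.
  have hEVI : ∀ t, s ≤ t → ‖Y t - w‖ ^ 2 - ‖Y s - w‖ ^ 2 ≤
      (t - s) * (2 * ⟪Y s - w, -b⟫ + 2 * (C * (t - s)) * ‖-b‖) := by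
    intro t hst
    have hJ : Tendsto (fun m : ℕ => ((⌊t * 2 ^ m⌋₊ - ⌊s * 2 ^ m⌋₊ : ℕ) : ℝ) * ((2 : ℝ) ^ m)⁻¹)
        atTop (𝓝 (t - s)) := by
      refine ((hfloor t (hs.trans hst)).sub (hfloor s hs)).congr fun m => ?_
      rw [Nat.cast_sub (Nat.floor_le_floor (by gcongr)), sub_mul]
    have hR := hJ.mul (((((hY s).sub_const w).inner hquot).const_mul 2).add
      (((hJ.const_mul (C : ℝ)).const_mul 2).mul hquot.norm) |>.add (hh.mul (hquot.norm.pow 2)))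
    rw [zero_mul, add_zero] at hR
    refine le_of_tendsto_of_tendsto' (((((hY t).sub_const w).norm.pow 2)).sub
      (((hY s).sub_const w).norm.pow 2)) hR fun m => ?_
    have hle : ⌊s * 2 ^ m⌋₊ ≤ ⌊t * 2 ^ m⌋₊ := Nat.floor_le_floor (by gcongr)
    have h1 := sq_norm_iterate_splitStep_sub_le_add hP hD (h := ((2 : ℝ) ^ m)⁻¹) (by positivity)
      hx hx' hw ⌊s * 2 ^ m⌋₊ _ _ (le_refl (⌊t * 2 ^ m⌋₊ - ⌊s * 2 ^ m⌋₊))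
    rw [Nat.add_sub_of_le hle] at h1
    rw [inner_smul_right, norm_smul, Real.norm_of_nonneg (by positivity : (0 : ℝ) ≤ 2 ^ m)]
    have h2 : (2 : ℝ) ^ m * ((2 : ℝ) ^ m)⁻¹ = 1 := mul_inv_cancel₀ (by positivity)
    unfold splitApprox
    set d := w - U.map (-((2 : ℝ) ^ m)⁻¹) w
    set J := ((⌊t * 2 ^ m⌋₊ - ⌊s * 2 ^ m⌋₊ : ℕ) : ℝ)
    set x := (splitStep P U ((2 : ℝ) ^ m)⁻¹)^[⌊s * 2 ^ m⌋₊] x₀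
    set N := (2 : ℝ) ^ m
    rw [sub_le_iff_le_add']
    refine h1.trans_eq ?_
    linear_combination (-(2 * J * ⟪x - w, d⟫) - 2 * C * J ^ 2 * N⁻¹ * ‖d‖
      - J * ‖d‖ ^ 2 * (1 + N * N⁻¹)) * h2
  have h1 : HasDerivAt (fun t => ‖Y t - w‖ ^ 2) (2 * ⟪Y s - w, y⟫) s := (hy.sub_const w).norm_sq
  have h2 := h1.tendsto_slope_zero_right
  have h3 : Tendsto (fun r : ℝ => 2 * ⟪Y s - w, -b⟫ + 2 * (C * r) * ‖-b‖) (𝓝[>] 0)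
      (𝓝 (2 * ⟪Y s - w, -b⟫ + 2 * (C * 0) * ‖-b‖)) :=
    ((by fun_prop : Continuous fun r : ℝ => 2 * ⟪Y s - w, -b⟫ + 2 * (C * r) * ‖-b‖).tendsto
      0).mono_left nhdsWithin_le_nhds
  have h4 := le_of_tendsto_of_tendsto h2 h3 (by
    filter_upwards [self_mem_nhdsWithin] with r hr
    have hr : (0 : ℝ) < r := hr
    have h5 := hEVI (s + r) (by linarith)
    rw [add_sub_cancel_left] at h5
    rw [smul_eq_mul, inv_mul_le_iff₀ hr]
    exact h5)
  rw [inner_neg_right] at h4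
  rw [real_inner_comm, real_inner_comm _ b]
  linarith

end Splitting

section Cones

variable {E : Type*} [NormedAddCommGroup E] [InnerProductSpace ℝ E] {K : Set E}

/-! ### Tangent and normal cones along a curve -/

theorem inner_nonpos_of_mem_normalConeTo {Y z v : E} (hz : z ∈ normalConeTo K Y)
    (hv : v ∈ tangentConeTo K Y) : ⟪z, v⟫ ≤ 0 := by
  have hcl : IsClosed {v : E | ⟪z, v⟫ ≤ 0} := isClosed_le (by fun_prop) continuous_const
  refine closure_minimal (fun v hv => ?_) hcl hv
  obtain ⟨h, hh, w, hw, rfl⟩ := hv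
  simp only [mem_ofPred_eq, inner_smul_right]
  exact mul_nonpos_of_nonneg_of_nonpos hh (hz w hw)

theorem convex_tangentConeTo (hK : Convex ℝ K) (Y : E) : Convex ℝ (tangentConeTo K Y) := by
  refine Convex.closure ?_
  rintro _ ⟨h₁, hh₁, w₁, hw₁, rfl⟩ _ ⟨h₂, hh₂, w₂, hw₂, rfl⟩ a b ha hb -
  have h0 : 0 ≤ a * h₁ + b * h₂ := by positivity
  rcases h0.eq_or_lt with h0 | hpos
  · have h1 : a * h₁ = 0 := by nlinarith [mul_nonneg ha hh₁, mul_nonneg hb hh₂]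
    have h2 : b * h₂ = 0 := by nlinarith [mul_nonneg ha hh₁, mul_nonneg hb hh₂]
    exact ⟨0, le_rfl, w₁, hw₁, by simp [smul_smul, h1, h2]⟩
  · refine ⟨a * h₁ + b * h₂, h0, _, hK hw₁ hw₂ (a := a * h₁ / (a * h₁ + b * h₂))
      (b := b * h₂ / (a * h₁ + b * h₂)) (by positivity) (by positivity) (by field_simp), ?_⟩
    have h1 : (a * h₁ + b * h₂) * (a * h₁ / (a * h₁ + b * h₂)) = a * h₁ := by field_simp
    have h2 : (a * h₁ + b * h₂) * (b * h₂ / (a * h₁ + b * h₂)) = b * h₂ := by field_simp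
    simp only [smul_sub, smul_add, smul_smul, h1, h2, add_smul]
    abel

/-- At an interior time both the velocity of a curve in `K` and its opposite are tangent to `K`,
by the forward and the backward difference quotients. -/
theorem deriv_mem_tangentConeTo {Y : ℝ → E} (hY : ∀ t, 0 ≤ t → Y t ∈ K) {t : ℝ} (ht : 0 < t)
    {y : E} (hy : HasDerivAt Y y t) :
    y ∈ tangentConeTo K (Y t) ∧ -y ∈ tangentConeTo K (Y t) := by
  constructor
  · refine mem_closure_of_tendsto hy.tendsto_slope_zero_right ?_
    filter_upwards [self_mem_nhdsWithin] with r hr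
    have hr : (0 : ℝ) < r := hr
    exact ⟨r⁻¹, (inv_pos.2 hr).le, _, hY _ (by linarith), rfl⟩
  · refine mem_closure_of_tendsto hy.tendsto_slope_zero_left.neg ?_
    have h1 : ∀ᶠ r : ℝ in 𝓝[<] 0, -t < r :=
      nhdsWithin_le_nhds (Ioi_mem_nhds (by linarith))
    filter_upwards [self_mem_nhdsWithin, h1] with r hr hr'
    have hr : r < 0 := hr
    exact ⟨-r⁻¹, (neg_pos.2 (inv_lt_zero.2 hr)).le, Y (t + r), hY _ (by linarith), by rw [neg_smul]⟩

theorem inner_deriv_eq_zero_of_mem_normalConeTo {Y y z : E} (hy : y ∈ tangentConeTo K Y)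
    (hy' : -y ∈ tangentConeTo K Y) (hz : z ∈ normalConeTo K Y) : ⟪z, y⟫ = 0 := by
  have h1 := inner_nonpos_of_mem_normalConeTo hz hy
  have h2 := inner_nonpos_of_mem_normalConeTo hz hy'
  rw [inner_neg_right] at h2
  linarith

/-- The velocity is orthogonal to every normal vector `z`, so `‖y‖² = -⟪z + b, y⟫`. -/
theorem isLeast_norm_deriv {Y y b : E} (hy : y ∈ tangentConeTo K Y)
    (hy' : -y ∈ tangentConeTo K Y) (h : -(y + b) ∈ normalConeTo K Y) :
    IsLeast ((fun z => ‖z + b‖) '' normalConeTo K Y) ‖y‖ := by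
  have h0 : -(y + b) + b = -y := by abel
  refine ⟨⟨_, h, by simp only [h0, norm_neg]⟩, ?_⟩
  rintro _ ⟨z, hz, rfl⟩
  have h1 := inner_deriv_eq_zero_of_mem_normalConeTo hy hy' h
  have h2 := inner_deriv_eq_zero_of_mem_normalConeTo hy hy' hz
  have h3 : ‖y‖ * ‖y‖ = -⟪z + b, y⟫ := by
    rw [← real_inner_self_eq_norm_mul_norm]
    simp only [inner_neg_left, inner_add_left] at h1 ⊢
    linarith
  have h4 := (neg_le_abs _).trans (abs_real_inner_le_norm (z + b) y)
  by_contra! hlt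
  nlinarith [norm_nonneg (z + b)]

/-- With `z = -(y + b)` one has `⟪v + b, -z⟫ = ‖z‖² - ⟪z, v⟫ ≥ ‖z‖²` for tangent `v`. -/
theorem isLeast_norm_deriv_add {Y y b : E} (hy : y ∈ tangentConeTo K Y)
    (hy' : -y ∈ tangentConeTo K Y) (h : -(y + b) ∈ normalConeTo K Y) :
    IsLeast ((fun v => ‖v + b‖) '' tangentConeTo K Y) ‖y + b‖ := by
  refine ⟨⟨y, hy, rfl⟩, ?_⟩
  rintro _ ⟨v, hv, rfl⟩
  have h1 := inner_deriv_eq_zero_of_mem_normalConeTo hy hy' h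
  have h2 := inner_nonpos_of_mem_normalConeTo h hv
  have h3 : ‖y + b‖ * ‖y + b‖ ≤ ⟪v + b, y + b⟫ := by
    rw [← real_inner_self_eq_norm_mul_norm]
    rw [inner_neg_left] at h1 h2
    have h4 : ⟪v + b, y + b⟫ = ⟪y + b, y + b⟫ + ⟪y + b, v⟫ - ⟪y + b, y⟫ := by
      rw [real_inner_comm, ← inner_add_right, ← inner_sub_right]
      congr 1
      abel
    linarith
  have h4 := real_inner_le_norm (v + b) (y + b)
  by_contra! hlt
  nlinarith [norm_nonneg (v + b)]

/-- A tangent vector `y` that minimizes `‖v + b‖` over the tangent cone satisfies the inclusion: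
the first-order condition at `y`, tested with `l (w - Y)` for `l → ∞`. -/
theorem neg_mem_normalConeTo_of_isLeast (hK : Convex ℝ K) {Y y b : E}
    (hy : y ∈ tangentConeTo K Y)
    (h : IsLeast ((fun v => ‖v + b‖) '' tangentConeTo K Y) ‖y + b‖) :
    -(y + b) ∈ normalConeTo K Y := by
  intro w hw
  have hvar : ∀ v ∈ tangentConeTo K Y, ⟪-b - y, v - y⟫ ≤ 0 := by
    refine (norm_eq_iInf_iff_real_inner_le_zero (convex_tangentConeTo hK Y) hy).1 ?_
    have heq : ∀ v : E, ‖-b - v‖ = ‖v + b‖ := fun v => by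
      rw [← norm_neg]
      congr 1
      abel
    have : Nonempty (tangentConeTo K Y) := ⟨⟨y, hy⟩⟩
    refine le_antisymm (le_ciInf fun v => ?_)
      (ciInf_le ⟨0, by rintro _ ⟨v, rfl⟩; exact norm_nonneg _⟩ (⟨y, hy⟩ : tangentConeTo K Y))
    rw [heq, heq]
    exact h.2 ⟨v, v.2, rfl⟩
  by_contra! hpos
  set p := ⟪-(y + b), w - Y⟫ with hp
  have h1 := hvar ((((|⟪-(y + b), y⟫| + 1) / p)) • (w - Y))
    (subset_closure ⟨_, by positivity, w, hw, rfl⟩)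
  have h2 : -b - y = -(y + b) := by abel
  rw [h2, inner_sub_right, inner_smul_right, ← hp, div_mul_cancel₀ _ hpos.ne'] at h1
  linarith [le_abs_self ⟪-(y + b), y⟫]

end Cones

/-! ### Shears of the torus -/

section Shear

variable {n : ℕ} {L : ℝ}

/-- The projection `ℝⁿ → (ℝ / 2Lℤ)ⁿ`. -/
def toTorus (v : Fin n → ℝ) : Torus n L := fun i => (v i : AddCircle (2 * L))

theorem toTorus_zero : toTorus (0 : Fin n → ℝ) = (0 : Torus n L) := by
  ext i
  simp [toTorus]

theorem toTorus_add (v w : Fin n → ℝ) :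
    (toTorus (v + w) : Torus n L) = toTorus v + toTorus w := by
  ext i
  simp [toTorus]

theorem isOpenQuotientMap_toTorus : IsOpenQuotientMap (toTorus : (Fin n → ℝ) → Torus n L) :=
  IsOpenQuotientMap.piMap fun _ => QuotientAddGroup.isOpenQuotientMap_mk

theorem toTorus_surjective : Function.Surjective (toTorus : (Fin n → ℝ) → Torus n L) :=
  isOpenQuotientMap_toTorus.surjective

theorem continuous_toTorus : Continuous (toTorus : (Fin n → ℝ) → Torus n L) :=
  isOpenQuotientMap_toTorus.continuous

/-- The shear `(x, u) ↦ (x + c(u), u)`. -/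
def shearMap (c : unitInterval → Fin n → ℝ) (p : Torus n L × unitInterval) :
    Torus n L × unitInterval :=
  (p.1 + toTorus (c p.2), p.2)

variable [Fact (0 < 2 * L)]

theorem measurePreserving_shearMap {c : unitInterval → Fin n → ℝ} (hc : Measurable c) :
    MeasurePreserving (shearMap c : Torus n L × unitInterval → Torus n L × unitInterval) := by
  have h1 : MeasurePreserving
      (fun p : unitInterval × Torus n L => (p.1, p.2 + toTorus (c p.1)))
      (volume.prod volume) (volume.prod volume) := by
    refine (MeasurePreserving.id volume).skew_product
      (g := fun (u : unitInterval) (x : Torus n L) => x + toTorus (c u)) ?_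
      (ae_of_all _ fun u => (measurePreserving_add_right volume _).map_eq)
    exact measurable_snd.add (continuous_toTorus.measurable.comp (hc.comp measurable_fst))
  exact Measure.measurePreserving_swap.comp (h1.comp Measure.measurePreserving_swap)

/-- Composition with a shear, as an isometry of `ℍ`. -/
noncomputable def shear (c : unitInterval → Fin n → ℝ) (hc : Measurable c) :
    KineticSpace n L →ₗᵢ[ℝ] KineticSpace n L :=
  Lp.compMeasurePreservingₗᵢ ℝ (shearMap c) (measurePreserving_shearMap hc)

theorem coeFn_shear {c : unitInterval → Fin n → ℝ} (hc : Measurable c) (Y : KineticSpace n L) :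
    shear c hc Y =ᵐ[volume] fun p => Y (shearMap c p) :=
  Lp.coeFn_compMeasurePreserving Y (measurePreserving_shearMap hc)

theorem coeFn_comp_shearMap {c : unitInterval → Fin n → ℝ} (hc : Measurable c)
    {f g : Torus n L × unitInterval → ℝ} (h : f =ᵐ[volume] g) :
    (fun p => f (shearMap c p)) =ᵐ[volume] fun p => g (shearMap c p) :=
  (measurePreserving_shearMap hc).quasiMeasurePreserving.ae_eq_comp h

theorem shear_shear {c c' : unitInterval → Fin n → ℝ} (hc : Measurable c) (hc' : Measurable c')
    (Y : KineticSpace n L) :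
    shear c hc (shear c' hc' Y) = shear (c + c') (hc.add hc') Y := by
  refine Lp.ext ?_
  filter_upwards [coeFn_shear hc (shear c' hc' Y), coeFn_shear (hc.add hc') Y,
    coeFn_comp_shearMap hc (coeFn_shear hc' Y)] with p h1 h2 h3
  rw [h1, h2, h3]
  simp [shearMap, toTorus_add, add_assoc]

theorem shear_comm {c c' : unitInterval → Fin n → ℝ} (hc : Measurable c) (hc' : Measurable c')
    (Y : KineticSpace n L) : shear c hc (shear c' hc' Y) = shear c' hc' (shear c hc Y) := by
  rw [shear_shear, shear_shear]
  simp only [add_comm c c']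

theorem shear_zero (Y : KineticSpace n L) : shear (fun _ => 0) measurable_const Y = Y := by
  refine Lp.ext ?_
  filter_upwards [coeFn_shear measurable_const Y] with p h1
  rw [h1]
  simp [shearMap, toTorus_zero]

/-- The group `Y(x, u) ↦ Y(x + r c(u), u)`. -/
noncomputable def shearGroup (c : unitInterval → Fin n → ℝ) (hc : Measurable c) :
    IsometryGroup (KineticSpace n L) where
  map r := shear (fun u => r • c u) (hc.const_smul r)
  map_zero' Y := by
    convert! shear_zero Y
    simp
  map_add' r s Y := by
    rw [shear_shear]
    simp only [add_smul]
    rfl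

/-- Translations in the direction of the `i`-th coordinate. -/
noncomputable def coordGroup (i : Fin n) : IsometryGroup (KineticSpace n L) :=
  shearGroup (fun _ => Pi.single i 1) measurable_const

theorem shearGroup_comm {c c' : unitInterval → Fin n → ℝ} (hc : Measurable c)
    (hc' : Measurable c') (r s : ℝ) (Y : KineticSpace n L) :
    (shearGroup c hc).map r ((shearGroup c' hc').map s Y) =
      (shearGroup c' hc').map s ((shearGroup c hc).map r Y) :=
  shear_comm (hc.const_smul r) (hc'.const_smul s) Y

/-- Multiplication by a bounded measurable function `a(u)`. -/
noncomputable def fiberMul (a : unitInterval → ℝ) (ha : Measurable a) {C : ℝ}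
    (hC : ∀ u, |a u| ≤ C) : KineticSpace n L →L[ℝ] KineticSpace n L :=
  (ContinuousLinearMap.mul ℝ ℝ).holderL volume ⊤ 2 2
    ((memLp_top_of_bound (ha.comp measurable_snd).aestronglyMeasurable C
      (ae_of_all _ fun p => hC p.2)).toLp (fun p : Torus n L × unitInterval => a p.2))

section FiberMul

variable {a : unitInterval → ℝ} (ha : Measurable a) {C : ℝ} (hC : ∀ u, |a u| ≤ C)

theorem coeFn_fiberMul (Y : KineticSpace n L) :
    fiberMul a ha hC Y =ᵐ[volume] fun p => a p.2 * Y p := by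
  filter_upwards [ContinuousLinearMap.coeFn_holder (ContinuousLinearMap.mul ℝ ℝ) (r := 2)
    ((memLp_top_of_bound (ha.comp measurable_snd).aestronglyMeasurable C
      (ae_of_all _ fun p => hC p.2)).toLp (fun p : Torus n L × unitInterval => a p.2)) Y,
    (memLp_top_of_bound (ha.comp measurable_snd).aestronglyMeasurable C
      (ae_of_all _ fun p => hC p.2)).coeFn_toLp (μ := volume)
      (f := fun p : Torus n L × unitInterval => a p.2)] with p h1 h2
  rw [fiberMul, ContinuousLinearMap.holderL_apply_apply, h1, h2]
  rfl

theorem inner_fiberMul (Y Z : KineticSpace n L) :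
    ⟪fiberMul a ha hC Y, Z⟫ = ⟪Y, fiberMul a ha hC Z⟫ := by
  rw [L2.inner_def, L2.inner_def]
  refine integral_congr_ae ?_
  filter_upwards [coeFn_fiberMul ha hC Y, coeFn_fiberMul ha hC Z] with p h1 h2
  rw [h1, h2]
  simp only [RCLike.inner_apply, conj_trivial]
  ring

theorem shear_fiberMul {c : unitInterval → Fin n → ℝ} (hc : Measurable c) (Y : KineticSpace n L) :
    shear c hc (fiberMul a ha hC Y) = fiberMul a ha hC (shear c hc Y) := by
  refine Lp.ext ?_
  filter_upwards [coeFn_shear hc (fiberMul a ha hC Y), coeFn_shear hc Y,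
    coeFn_fiberMul ha hC (shear c hc Y), coeFn_comp_shearMap hc (coeFn_fiberMul ha hC Y)]
    with p h1 h2 h3 h4
  rw [h1, h3, h4, h2]
  rfl

end FiberMul

end Shear

/-! ### Test functions -/

section TestFunction

variable {n : ℕ} {L : ℝ}


/-- The partial derivative of a test function, as a function of all variables. -/
noncomputable def testPartial (i : Fin n) (φ : Torus n L → ℝ → ℝ) (x : Torus n L) (u : ℝ) : ℝ :=
  torusPartial i (fun x => φ x u) x

variable {φ : Torus n L → ℝ → ℝ}

theorem continuous_of_isTestFunction (hφ : IsTestFunction φ) :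
    Continuous fun p : Torus n L × ℝ => φ p.1 p.2 := by
  have hq : IsOpenQuotientMap (Prod.map (toTorus : (Fin n → ℝ) → Torus n L) (id : ℝ → ℝ)) :=
    isOpenQuotientMap_toTorus.prodMap IsOpenQuotientMap.id
  rw [hq.isQuotientMap.continuous_iff]
  exact hφ.continuous

theorem hasDerivAt_line (hφ : IsTestFunction φ) (y v : Fin n → ℝ) (u s : ℝ) :
    HasDerivAt (fun s : ℝ => φ (toTorus (y + s • v)) u)
      (fderiv ℝ (fun p : (Fin n → ℝ) × ℝ => φ (toTorus p.1) p.2) (y + s • v, u) (v, 0)) s := by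
  have h1 : HasFDerivAt (fun p : (Fin n → ℝ) × ℝ => φ (toTorus p.1) p.2) _ (y + s • v, u) :=
    (hφ.differentiable (by simp) (y + s • v, u)).hasFDerivAt
  have h2 : HasDerivAt (fun s : ℝ => (y + s • v, u)) (v, (0 : ℝ)) s := by
    have h3 : HasDerivAt (fun s : ℝ => y + s • v) v s := by
      simpa using ((hasDerivAt_id s).smul_const v).const_add y
    exact h3.prodMk (hasDerivAt_const s u)
  exact h1.comp_hasDerivAt s h2

theorem toTorus_single (i : Fin n) (s : ℝ) :
    (toTorus (s • Pi.single i 1) : Torus n L) = Pi.single i (s : AddCircle (2 * L)) := by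
  ext j
  rcases eq_or_ne j i with rfl | h
  · simp [toTorus]
  · simp [toTorus, h]

theorem testPartial_toTorus (hφ : IsTestFunction φ) (i : Fin n) (y : Fin n → ℝ) (u : ℝ) :
    testPartial i φ (toTorus y) u =
      fderiv ℝ (fun p : (Fin n → ℝ) × ℝ => φ (toTorus p.1) p.2) (y, u) (Pi.single i 1, 0) := by
  have h := (hasDerivAt_line hφ y (Pi.single i 1) u 0).deriv
  simp only [toTorus_add, toTorus_single, zero_smul, add_zero] at h
  exact h

theorem isTestFunction_testPartial (hφ : IsTestFunction φ) (i : Fin n) :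
    IsTestFunction (testPartial i φ) := by
  have h : (fun p : (Fin n → ℝ) × ℝ => testPartial i φ (toTorus p.1) p.2) = fun p =>
      fderiv ℝ (fun p : (Fin n → ℝ) × ℝ => φ (toTorus p.1) p.2) p (Pi.single i 1, 0) := by
    ext p
    exact testPartial_toTorus hφ i p.1 p.2
  change ContDiff ℝ ∞ (fun p : (Fin n → ℝ) × ℝ => testPartial i φ (toTorus p.1) p.2)
  rw [h]
  exact (ContDiff.fderiv_right (m := ∞) hφ (by simp)).clm_apply contDiff_const

theorem hasDerivAt_testFunction (hφ : IsTestFunction φ) (x : Torus n L) (v : Fin n → ℝ) (u s : ℝ) :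
    HasDerivAt (fun s : ℝ => φ (x + toTorus (s • v)) u)
      (∑ i, v i * testPartial i φ (x + toTorus (s • v)) u) s := by
  obtain ⟨y, rfl⟩ := toTorus_surjective x
  simp only [← toTorus_add]
  convert! hasDerivAt_line hφ y v u s using 1
  have hv : (v, (0 : ℝ)) = ∑ i, v i • ((Pi.single i 1, 0) : (Fin n → ℝ) × ℝ) := by
    ext j
    · simp [Prod.fst_sum, Finset.sum_apply, Pi.single_apply]
    · simp [Prod.snd_sum]
  rw [hv, map_sum]
  refine Finset.sum_congr rfl fun i _ => ?_
  rw [map_smul, testPartial_toTorus hφ, smul_eq_mul]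

theorem isTestFunction_translate (hφ : IsTestFunction φ) (v : Fin n → ℝ) :
    IsTestFunction fun x u => φ (x + toTorus v) u := by
  have h : ContDiff ℝ ∞ fun p : (Fin n → ℝ) × ℝ => (p.1 + v, p.2) := by fun_prop
  have h2 := ContDiff.comp (g := fun p : (Fin n → ℝ) × ℝ => φ (toTorus p.1) p.2) hφ h
  have h3 : (fun p : (Fin n → ℝ) × ℝ => φ (toTorus p.1 + toTorus v) p.2) =
      (fun p : (Fin n → ℝ) × ℝ => φ (toTorus p.1) p.2) ∘ fun p => (p.1 + v, p.2) := by
    ext p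
    simp [toTorus_add]
  change ContDiff ℝ ∞ (fun p : (Fin n → ℝ) × ℝ => φ (toTorus p.1 + toTorus v) p.2)
  rwa [h3]

theorem testPartial_translate (i : Fin n) (v : Fin n → ℝ) :
    testPartial i (fun x u => φ (x + toTorus v) u) =
      fun (x : Torus n L) u => testPartial i φ (x + toTorus v) u := by
  ext x u
  simp only [testPartial, torusPartial, add_right_comm]

variable [Fact (0 < 2 * L)]

theorem exists_bound_testFunction (hφ : IsTestFunction φ) :
    ∃ M : ℝ, 0 ≤ M ∧ ∀ (x : Torus n L) (u : unitInterval), |φ x u| ≤ M := by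
  have hc : Continuous fun p : Torus n L × unitInterval => φ p.1 p.2 :=
    (continuous_of_isTestFunction hφ).comp
      (continuous_fst.prodMk (continuous_subtype_val.comp continuous_snd))
  obtain ⟨M, hM⟩ := isCompact_univ.exists_bound_of_continuousOn hc.continuousOn
  exact ⟨|M|, abs_nonneg M, fun x u => (hM (x, u) (mem_univ _)).trans (le_abs_self M)⟩

theorem exists_lipschitz_testFunction (hφ : IsTestFunction φ) :
    ∃ M : ℝ, 0 ≤ M ∧ ∀ (x : Torus n L) (u : unitInterval) (v : Fin n → ℝ) (C : ℝ),
      (∀ i, |v i| ≤ C) → |φ (x + toTorus v) u - φ x u| ≤ M * C := by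
  choose M hM0 hM using fun i => exists_bound_testFunction (isTestFunction_testPartial hφ i)
  refine ⟨∑ i, M i, Finset.sum_nonneg fun i _ => hM0 i, fun x u v C hv => ?_⟩
  have h := Convex.norm_image_sub_le_of_norm_hasDerivWithin_le (s := univ) (x := 0) (y := 1)
    (C := (∑ i, M i) * C)
    (fun s _ => (hasDerivAt_testFunction hφ x v u s).hasDerivWithinAt) (fun s _ => ?_) convex_univ
    (mem_univ _) (mem_univ _)
  · simpa [toTorus_zero] using h
  · rw [Finset.sum_mul]
    refine (norm_sum_le _ _).trans (Finset.sum_le_sum fun i _ => ?_)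
    rw [norm_mul, mul_comm, Real.norm_eq_abs, Real.norm_eq_abs]
    exact mul_le_mul (hM i _ _) (hv i) (abs_nonneg _) (hM0 i)

/-- First-order Taylor expansion in `x`, uniformly in `(x, u)`. -/
theorem exists_taylor_testFunction (hφ : IsTestFunction φ) :
    ∃ M : ℝ, 0 ≤ M ∧ ∀ (x : Torus n L) (u : unitInterval) (v : Fin n → ℝ) (C : ℝ),
      (∀ i, |v i| ≤ C) →
        |φ (x + toTorus v) u - φ x u - ∑ i, v i * testPartial i φ x u| ≤ M * C ^ 2 := by
  choose M hM0 hM using fun i => exists_lipschitz_testFunction (isTestFunction_testPartial hφ i)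
  refine ⟨∑ i, M i, Finset.sum_nonneg fun i _ => hM0 i, fun x u v C hv => ?_⟩
  have h := Convex.norm_image_sub_le_of_norm_hasDerivWithin_le (s := Icc 0 1) (x := 0) (y := 1)
    (C := (∑ i, M i) * C ^ 2)
    (fun s _ => ((hasDerivAt_testFunction hφ x v u s).sub
      ((hasDerivAt_id s).mul_const (∑ i, v i * testPartial i φ x u))).hasDerivWithinAt)
    (fun s hs => ?_) (convex_Icc 0 1) (by simp) (by simp)
  · simp only [Pi.sub_apply, id, one_mul, zero_mul, one_smul, zero_smul, toTorus_zero, add_zero,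
      sub_zero, norm_one, mul_one, Real.norm_eq_abs] at h
    rwa [sub_right_comm] at h
  · rw [Finset.sum_mul, one_mul, ← Finset.sum_sub_distrib]
    refine (norm_sum_le _ _).trans (Finset.sum_le_sum fun i _ => ?_)
    have hC : 0 ≤ C := (abs_nonneg _).trans (hv i)
    have h1 := hM i x u (s • v) C (fun j => by
      rw [Pi.smul_apply, smul_eq_mul, abs_mul, abs_of_nonneg hs.1]
      exact (mul_le_of_le_one_left (abs_nonneg _) hs.2).trans (hv j))
    rw [← mul_sub, norm_mul, Real.norm_eq_abs, Real.norm_eq_abs]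
    calc |v i| * |testPartial i φ (x + toTorus (s • v)) u - testPartial i φ x u|
        ≤ C * (M i * C) := mul_le_mul (hv i) h1 (abs_nonneg _) hC
      _ = M i * C ^ 2 := by ring

/-- A test function as a continuous function on the compact space `𝕋ⁿ × [0, 1]`. -/
def testMap (φ : Torus n L → ℝ → ℝ) (hφ : IsTestFunction φ) : C(Torus n L × unitInterval, ℝ) where
  toFun p := φ p.1 p.2
  continuous_toFun := (continuous_of_isTestFunction hφ).comp
    (continuous_fst.prodMk (continuous_subtype_val.comp continuous_snd))

/-- A test function as an element of `ℍ`. -/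
noncomputable def testLp (φ : Torus n L → ℝ → ℝ) (hφ : IsTestFunction φ) : KineticSpace n L :=
  ContinuousMap.toLp 2 volume ℝ (testMap φ hφ)

theorem coeFn_testLp (hφ : IsTestFunction φ) :
    testLp φ hφ =ᵐ[volume] fun p => φ p.1 p.2 :=
  ContinuousMap.coeFn_toLp volume (testMap φ hφ)

/-- The algebra of test functions, restricted to `𝕋ⁿ × [0, 1]`. -/
def testAlgebra (n : ℕ) (L : ℝ) [Fact (0 < 2 * L)] :
    Subalgebra ℝ C(Torus n L × unitInterval, ℝ) where
  carrier := {g | ∃ φ, ∃ hφ : IsTestFunction φ, testMap φ hφ = g}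
  mul_mem' := by
    rintro _ _ ⟨φ, hφ, rfl⟩ ⟨ψ, hψ, rfl⟩
    exact ⟨fun x u => φ x u * ψ x u, ContDiff.mul hφ hψ, rfl⟩
  add_mem' := by
    rintro _ _ ⟨φ, hφ, rfl⟩ ⟨ψ, hψ, rfl⟩
    exact ⟨fun x u => φ x u + ψ x u, ContDiff.add hφ hψ, rfl⟩
  algebraMap_mem' r := ⟨fun _ _ => r, contDiff_const, rfl⟩

theorem separatesPoints_testAlgebra : (testAlgebra n L).SeparatesPoints := by
  have hcirc : ∀ i : Fin n, ContDiff ℝ ∞ fun p : (Fin n → ℝ) × ℝ =>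
      Complex.exp ((2 * Real.pi / (2 * L) * p.1 i : ℝ) * Complex.I) := by
    intro i
    have h1 : ContDiff ℝ ∞ fun p : (Fin n → ℝ) × ℝ => 2 * Real.pi / (2 * L) * p.1 i := by fun_prop
    have h2 : ContDiff ℝ ∞ fun p : (Fin n → ℝ) × ℝ =>
        ((2 * Real.pi / (2 * L) * p.1 i : ℝ) : ℂ) := Complex.ofRealCLM.contDiff.comp h1
    exact (h2.mul contDiff_const).cexp
  have heq : ∀ (i : Fin n) (p : (Fin n → ℝ) × ℝ),
      ((AddCircle.toCircle (p.1 i : AddCircle (2 * L)) : Circle) : ℂ) =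
        Complex.exp ((2 * Real.pi / (2 * L) * p.1 i : ℝ) * Complex.I) := by
    intro i p
    rw [AddCircle.toCircle_apply_mk, Circle.coe_exp]
  have hre : ∀ i : Fin n, IsTestFunction fun (x : Torus n L) (_ : ℝ) =>
      ((AddCircle.toCircle (x i) : Circle) : ℂ).re := by
    intro i
    simp only [IsTestFunction, heq]
    exact Complex.reCLM.contDiff.comp (hcirc i)
  have him : ∀ i : Fin n, IsTestFunction fun (x : Torus n L) (_ : ℝ) =>
      ((AddCircle.toCircle (x i) : Circle) : ℂ).im := by
    intro i
    simp only [IsTestFunction, heq]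
    exact Complex.imCLM.contDiff.comp (hcirc i)
  have hu : IsTestFunction fun (_ : Torus n L) (u : ℝ) => u := contDiff_snd
  rintro ⟨x, u⟩ ⟨y, w⟩ hne
  by_contra! hall
  have hsep : ∀ φ (hφ : IsTestFunction φ), φ x u = φ y w := fun φ hφ =>
    hall (testMap φ hφ) ⟨_, ⟨φ, hφ, rfl⟩, rfl⟩
  refine hne (Prod.ext (funext fun i => ?_) (Subtype.ext (hsep _ hu)))
  refine AddCircle.injective_toCircle (Fact.out : 0 < 2 * L).ne' (Subtype.ext ?_)
  exact Complex.ext (hsep _ (hre i)) (hsep _ (him i))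

theorem dense_testLp :
    Dense {Y : KineticSpace n L | ∃ φ, ∃ hφ : IsTestFunction φ, testLp φ hφ = Y} := by
  have h1 : Dense ((testAlgebra n L : Subalgebra ℝ C(Torus n L × unitInterval, ℝ)) :
      Set C(Torus n L × unitInterval, ℝ)) := by
    have h := ContinuousMap.subalgebra_topologicalClosure_eq_top_of_separatesPoints
      (testAlgebra n L) separatesPoints_testAlgebra
    rw [dense_iff_closure_eq, ← Subalgebra.topologicalClosure_coe, h]
    rfl
  have h2 := (ContinuousMap.toLp_denseRange (p := 2) ℝ
    (volume : Measure (Torus n L × unitInterval)) ℝ (by simp)).dense_image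
    (ContinuousMap.toLp 2 volume ℝ).continuous h1
  refine h2.mono ?_
  rintro _ ⟨_, ⟨φ, hφ, rfl⟩, rfl⟩
  exact ⟨φ, hφ, rfl⟩

end TestFunction

variable {n : ℕ} {L : ℝ} [Fact (0 < 2 * L)]

/-! ### Weak gradients and generators of shears -/

section WeakGradient

theorem shear_testLp_translate {φ : Torus n L → ℝ → ℝ} (hφ : IsTestFunction φ) (i : Fin n)
    (r : ℝ) :
    (coordGroup i).map r (testLp φ hφ) =
      testLp _ (isTestFunction_translate hφ (r • Pi.single i 1)) := by
  have hc : Measurable fun _ : unitInterval => r • (Pi.single i 1 : Fin n → ℝ) := measurable_const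
  refine Lp.ext ?_
  filter_upwards [coeFn_shear hc (testLp φ hφ), coeFn_comp_shearMap hc (coeFn_testLp hφ),
    coeFn_testLp (isTestFunction_translate hφ (r • Pi.single i 1))] with p h1 h2 h3
  exact h1.trans (h2.trans h3.symm)

/-- On test functions a shear group is differentiable in `ℍ`, with the expected derivative. -/
theorem hasDerivAt_shearGroup_testLp {c : unitInterval → Fin n → ℝ} (hc : Measurable c) {C : ℝ}
    (hC : ∀ u i, |c u i| ≤ C) {φ : Torus n L → ℝ → ℝ} (hφ : IsTestFunction φ)
    {Φ : KineticSpace n L}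
    (hΦ : Φ =ᵐ[volume] fun p => ∑ i, c p.2 i * testPartial i φ p.1 p.2) :
    HasDerivAt (fun r => (shearGroup c hc).map r (testLp φ hφ)) Φ 0 := by
  obtain ⟨M, hM0, hM⟩ := exists_taylor_testFunction hφ
  set V : ℝ := (measureUnivNNReal (volume : Measure (Torus n L × unitInterval)) : ℝ) ^
    (2 : ENNReal).toReal⁻¹ with hV
  have hV0 : 0 ≤ V := by positivity
  have hquad : ∀ r : ℝ, ‖(shearGroup c hc).map r (testLp φ hφ) - testLp φ hφ - r • Φ‖
      ≤ V * (M * (|r| * |C|) ^ 2) := by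
    intro r
    refine Lp.norm_le_of_ae_bound (by positivity) ?_
    have hcr : Measurable fun u => r • c u := hc.const_smul r
    filter_upwards [hΦ, coeFn_testLp hφ, coeFn_shear hcr (testLp φ hφ),
      coeFn_comp_shearMap hcr (coeFn_testLp hφ),
      Lp.coeFn_sub ((shearGroup c hc).map r (testLp φ hφ) - testLp φ hφ) (r • Φ),
      Lp.coeFn_sub ((shearGroup c hc).map r (testLp φ hφ)) (testLp φ hφ), Lp.coeFn_smul r Φ]
      with p h1 h2 h3 h4 h5 h6 h7
    rw [h5, Pi.sub_apply, h6, Pi.sub_apply, h7, Pi.smul_apply, h1, h2]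
    have h8 : ((shearGroup c hc).map r (testLp φ hφ) : Torus n L × unitInterval → ℝ) p =
      φ (p.1 + toTorus (r • c p.2)) p.2 := h3.trans h4
    rw [h8, smul_eq_mul, Finset.mul_sum, Real.norm_eq_abs]
    have h9 := hM p.1 p.2 (r • c p.2) (|r| * |C|) (fun i => by
      rw [Pi.smul_apply, smul_eq_mul, abs_mul]
      exact mul_le_mul_of_nonneg_left ((hC _ _).trans (le_abs_self C)) (abs_nonneg r))
    simpa only [Pi.smul_apply, smul_eq_mul, mul_assoc] using h9
  rw [hasDerivAt_iff_isLittleO]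
  simp only [IsometryGroup.map_zero', sub_zero]
  have hO : (fun r : ℝ => (shearGroup c hc).map r (testLp φ hφ) - testLp φ hφ - r • Φ)
      =O[𝓝 0] fun r : ℝ => r ^ 2 := by
    refine Asymptotics.IsBigO.of_bound (V * (M * |C| ^ 2)) (Eventually.of_forall fun r => ?_)
    refine (hquad r).trans_eq ?_
    rw [norm_pow, Real.norm_eq_abs]
    ring
  refine hO.trans_isLittleO ?_
  simpa using Asymptotics.isLittleO_pow_pow (𝕜 := ℝ) (one_lt_two)

theorem hasDerivAt_coordGroup_testLp {φ : Torus n L → ℝ → ℝ} (hφ : IsTestFunction φ) (i : Fin n) :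
    HasDerivAt (fun r => (coordGroup i).map r (testLp φ hφ))
      (testLp _ (isTestFunction_testPartial hφ i)) 0 := by
  refine hasDerivAt_shearGroup_testLp measurable_const (C := 1) (fun _ j => ?_) hφ ?_
  · rcases eq_or_ne j i with rfl | h <;> simp [*]
  · filter_upwards [coeFn_testLp (isTestFunction_testPartial hφ i)] with p hp
    rw [hp, Finset.sum_eq_single i (fun j _ hj => by simp [hj]) (by simp)]
    simp

theorem integral_eq_inner (Y Z : KineticSpace n L) {ψ : Torus n L × unitInterval → ℝ}
    (hZ : Z =ᵐ[volume] ψ) : ∫ p, Y p * ψ p = ⟪Y, Z⟫ := by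
  rw [L2.inner_def]
  refine integral_congr_ae ?_
  filter_upwards [hZ] with p hp
  rw [hp]
  simp [mul_comm]

theorem isWeakGrad_iff_inner {Y : KineticSpace n L} {G : Fin n → KineticSpace n L} :
    IsWeakGrad Y G ↔ ∀ i φ (hφ : IsTestFunction φ),
      ⟪Y, testLp _ (isTestFunction_testPartial hφ i)⟫ = -⟪G i, testLp φ hφ⟫ := by
  refine forall_congr' fun i => forall_congr' fun φ => forall_congr' fun hφ => ?_
  rw [← integral_eq_inner (G i) _ (coeFn_testLp hφ),
    ← integral_eq_inner Y _ (coeFn_testLp (isTestFunction_testPartial hφ i))]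
  rfl

/-- The weak gradient of `Y` is the derivative of `Y` along the coordinate translations in `ℍ`. -/
theorem isWeakGrad_iff_hasDerivAt {Y : KineticSpace n L} {G : Fin n → KineticSpace n L} :
    IsWeakGrad Y G ↔ ∀ i, HasDerivAt (fun r => (coordGroup i).map r Y) (G i) 0 := by
  rw [isWeakGrad_iff_inner]
  refine forall_congr' fun i => ⟨fun h => ?_, fun h φ hφ => ?_⟩
  · refine (coordGroup i).hasDerivAt_of_dense dense_testLp ?_
    rintro _ ⟨φ, hφ, rfl⟩
    refine ⟨_, hasDerivAt_coordGroup_testLp hφ i, fun r => ?_⟩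
    rw [shear_testLp_translate, shear_testLp_translate,
      ← h _ (isTestFunction_translate hφ (r • Pi.single i 1))]
    congr 2
    exact (testPartial_translate i _).symm
  · exact (coordGroup i).inner_generator h (hasDerivAt_coordGroup_testLp hφ i)

theorem IsWeakGrad.sub {Y Y' : KineticSpace n L} {G G' : Fin n → KineticSpace n L}
    (h : IsWeakGrad Y G) (h' : IsWeakGrad Y' G') : IsWeakGrad (Y - Y') fun i => G i - G' i := by
  rw [isWeakGrad_iff_inner] at *
  intro i φ hφ
  rw [inner_sub_left, inner_sub_left, h i φ hφ, h' i φ hφ]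
  ring

theorem dense_differentiable_coordGroup (i : Fin n) :
    Dense {Y : KineticSpace n L | ∃ Y', HasDerivAt (fun r => (coordGroup i).map r Y) Y' 0} := by
  refine dense_testLp.mono ?_
  rintro _ ⟨φ, hφ, rfl⟩
  exact ⟨_, hasDerivAt_coordGroup_testLp hφ i⟩

theorem coeFn_finsetSum {ι : Type*} (s : Finset ι) (Z : ι → KineticSpace n L) :
    (∑ i ∈ s, Z i : KineticSpace n L) =ᵐ[volume] fun p => ∑ i ∈ s, Z i p := by
  classical
  induction s using Finset.induction_on with
  | empty =>
    filter_upwards [Lp.coeFn_zero ℝ 2 (volume : Measure (Torus n L × unitInterval))] with p hp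
    rw [Finset.sum_empty, hp, Finset.sum_empty, Pi.zero_apply]
  | insert i s hi ih =>
    filter_upwards [Lp.coeFn_add (Z i) (∑ j ∈ s, Z j), ih] with p h1 h2
    rw [Finset.sum_insert hi, h1, Pi.add_apply, h2, Finset.sum_insert hi]

/-- If `Y` has the weak gradient `G`, the group of shears with velocity `c(u)` is differentiable
at `Y` with derivative `∑ᵢ cᵢ Gᵢ`. No regularity in `u` is needed, since multiplication by `cᵢ(u)`
commutes with the translations. -/
theorem hasDerivAt_shearGroup {c : unitInterval → Fin n → ℝ} (hc : Measurable c) {C : ℝ}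
    (hC : ∀ u i, |c u i| ≤ C) {Y B : KineticSpace n L} {G : Fin n → KineticSpace n L}
    (hG : IsWeakGrad Y G) (hB : B =ᵐ[volume] fun p => ∑ i, c p.2 i * G i p) :
    HasDerivAt (fun r => (shearGroup c hc).map r Y) B 0 := by
  rw [isWeakGrad_iff_hasDerivAt] at hG
  have hci : ∀ i, Measurable fun u => c u i := fun i => (measurable_pi_apply i).comp hc
  let m : Fin n → KineticSpace n L →L[ℝ] KineticSpace n L := fun i =>
    fiberMul (fun u => c u i) (hci i) (fun u => hC u i)
  have hsum : ∀ Z : Fin n → KineticSpace n L,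
      (∑ i, m i (Z i) : KineticSpace n L) =ᵐ[volume] fun p => ∑ i, c p.2 i * Z i p := by
    intro Z
    filter_upwards [coeFn_finsetSum Finset.univ fun i => m i (Z i),
      ae_all_iff.2 fun i => coeFn_fiberMul (hci i) (fun u => hC u i) (Z i)] with p h1 h2
    rw [h1]
    exact Finset.sum_congr rfl fun i _ => h2 i
  have hB' : B = ∑ i, m i (G i) := Lp.ext (hB.trans (hsum G).symm)
  refine (shearGroup c hc).hasDerivAt_of_dense dense_testLp ?_
  rintro _ ⟨φ, hφ, rfl⟩
  let Φ : Fin n → KineticSpace n L := fun i => testLp _ (isTestFunction_testPartial hφ i)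
  refine ⟨∑ i, m i (Φ i), hasDerivAt_shearGroup_testLp hc hC hφ ?_, fun r => ?_⟩
  · filter_upwards [hsum Φ, ae_all_iff.2 fun i =>
      coeFn_testLp (isTestFunction_testPartial hφ i)] with p h1 h2
    rw [h1]
    exact Finset.sum_congr rfl fun i _ => by rw [h2 i]
  rw [hB', map_sum, inner_sum, sum_inner, ← Finset.sum_neg_distrib]
  refine Finset.sum_congr rfl fun i _ => ?_
  have hcomm : ∀ Z : KineticSpace n L,
      (shearGroup c hc).map r (m i Z) = m i ((shearGroup c hc).map r Z) := fun Z =>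
    shear_fiberMul (hci i) (fun u => hC u i) (hc.const_smul r) Z
  rw [hcomm, inner_fiberMul (hci i) (fun u => hC u i)]
  -- The orbit of `cᵢ(u) φ(x + r c(u), u)` under translations is differentiable: both operations
  -- are continuous, linear and commute with translations.
  refine (coordGroup i).inner_generator (hG i) ?_
  have h1 := ((m i).comp
    ((shearGroup c hc).map r).toContinuousLinearMap).hasFDerivAt.comp_hasDerivAt (0 : ℝ)
      (hasDerivAt_coordGroup_testLp hφ i)
  refine h1.congr_of_eventuallyEq (Eventually.of_forall fun s => ?_)
  simp only [Function.comp, ContinuousLinearMap.comp_apply,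
    LinearIsometry.coe_toContinuousLinearMap]
  rw [show (shearGroup c hc).map r ((coordGroup i).map s (testLp φ hφ)) =
    (coordGroup i).map s ((shearGroup c hc).map r (testLp φ hφ)) from
      shearGroup_comm hc measurable_const r s _]
  exact shear_fiberMul (hci i) (fun u => hC u i) (measurable_const.const_smul s) _

/-- The elements of `ℍ` that are Lipschitz with constant `M` under each coordinate translation. -/
def translationLipschitz (n : ℕ) (L : ℝ) [Fact (0 < 2 * L)] (M : ℝ) : Set (KineticSpace n L) :=
  {Y | ∀ i r, ‖(coordGroup i).map r Y - Y‖ ≤ M * |r|}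

theorem isClosed_translationLipschitz (M : ℝ) : IsClosed (translationLipschitz n L M) := by
  simp only [translationLipschitz, ofPred_forall]
  refine isClosed_iInter fun i => isClosed_iInter fun r => ?_
  have h : Continuous fun Y : KineticSpace n L => (coordGroup i).map r Y - Y :=
    ((coordGroup i).map r).continuous.sub continuous_id
  exact isClosed_le h.norm continuous_const

theorem exists_isWeakGrad_of_mem {Y : KineticSpace n L} {M : ℝ}
    (hY : Y ∈ translationLipschitz n L M) :
    ∃ G : Fin n → KineticSpace n L, IsWeakGrad Y G ∧ ∀ i, ‖G i‖ ≤ M := by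
  choose G hG hG' using fun i => (coordGroup i).exists_hasDerivAt_of_lipschitz
    (dense_differentiable_coordGroup i) (hY i)
  exact ⟨G, isWeakGrad_iff_hasDerivAt.2 hG', hG⟩

theorem mem_translationLipschitz {Y : KineticSpace n L} {G : Fin n → KineticSpace n L}
    (hG : IsWeakGrad Y G) {M : ℝ} (hM : ∀ i, ‖G i‖ ≤ M) : Y ∈ translationLipschitz n L M :=
  fun i r => ((coordGroup i).norm_map_sub_self_le (isWeakGrad_iff_hasDerivAt.1 hG i) r).trans
    (mul_le_mul_of_nonneg_right (hM i) (abs_nonneg r))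

end WeakGradient

/-! ### The cone of functions monotone in the fibre variable -/

section Cone

theorem zero_mem_monotoneCone : (0 : KineticSpace n L) ∈ monotoneCone n L := by
  have h : ∀ᵐ p : Torus n L × unitInterval, (0 : KineticSpace n L) p = 0 := Lp.coeFn_zero _ _ _
  filter_upwards [Measure.ae_ae_of_ae_prod h] with x hx
  exact ⟨_, hx, fun u hu w hw _ => le_of_eq (Eq.trans hu (Eq.symm hw))⟩

theorem convex_monotoneCone : Convex ℝ (monotoneCone n L) := by
  intro Y hY Z hZ a b ha hb _
  have h : ∀ᵐ p : Torus n L × unitInterval, (a • Y + b • Z) p = a * Y p + b * Z p := by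
    filter_upwards [Lp.coeFn_add (a • Y) (b • Z), Lp.coeFn_smul a Y, Lp.coeFn_smul b Z]
      with p h1 h2 h3
    rw [h1, Pi.add_apply, h2, h3]
    rfl
  filter_upwards [hY, hZ, Measure.ae_ae_of_ae_prod h] with x ⟨S, hS, hYS⟩ ⟨T, hT, hZT⟩ hx
  refine ⟨S ∩ T ∩ {u | (a • Y + b • Z) (x, u) = a * Y (x, u) + b * Z (x, u)}, ?_, ?_⟩
  · filter_upwards [hS, hT, hx] with u h1 h2 h3 using ⟨⟨h1, h2⟩, h3⟩
  · rintro u ⟨⟨h1, h2⟩, h3⟩ w ⟨⟨h1', h2'⟩, h3'⟩ huw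
    have h4 := hYS h1 h1' huw
    have h5 := hZT h2 h2' huw
    have h3 : (a • Y + b • Z) (x, u) = a * Y (x, u) + b * Z (x, u) := h3
    have h3' : (a • Y + b • Z) (x, w) = a * Y (x, w) + b * Z (x, w) := h3'
    simp only [h3, h3']
    simp only at h4 h5
    gcongr

theorem isClosed_monotoneCone : IsClosed (monotoneCone n L) := by
  refine IsSeqClosed.isClosed fun Y Z hY hYZ => ?_
  obtain ⟨k, -, hk⟩ := (tendstoInMeasure_of_tendsto_Lp hYZ).exists_seq_tendsto_ae
  filter_upwards [Measure.ae_ae_of_ae_prod hk, ae_all_iff.2 fun j => hY j] with x hx hx'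
  choose S hS hm using hx'
  refine ⟨{u | (∀ j, u ∈ S j) ∧ Tendsto (fun j => Y (k j) (x, u)) atTop (𝓝 (Z (x, u)))}, ?_, ?_⟩
  · filter_upwards [ae_all_iff.2 hS, hx] with u h1 h2 using ⟨h1, h2⟩
  · rintro u ⟨h1, h2⟩ w ⟨h1', h2'⟩ huw
    exact le_of_tendsto_of_tendsto' h2 h2' fun j => hm (k j) (h1 _) (h1' _) huw

theorem coordGroup_mem_monotoneCone (i : Fin n) (r : ℝ) {Y : KineticSpace n L}
    (hY : Y ∈ monotoneCone n L) : (coordGroup i).map r Y ∈ monotoneCone n L := by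
  have hc : Measurable fun _ : unitInterval => r • (Pi.single i 1 : Fin n → ℝ) := measurable_const
  have h : ∀ᵐ p : Torus n L × unitInterval,
      (coordGroup i).map r Y p = Y (p.1 + toTorus (r • Pi.single i 1), p.2) := coeFn_shear hc Y
  have hY' := (measurePreserving_add_right volume
    (toTorus (r • Pi.single i 1) : Torus n L)).quasiMeasurePreserving.ae hY
  filter_upwards [hY', Measure.ae_ae_of_ae_prod h] with x ⟨S, hS, hm⟩ hx
  refine ⟨S ∩ {u | (coordGroup i).map r Y (x, u) = Y (x + toTorus (r • Pi.single i 1), u)}, ?_, ?_⟩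
  · filter_upwards [hS, hx] with u h1 h2 using ⟨h1, h2⟩
  · rintro u ⟨h1, h2⟩ w ⟨h1', h2'⟩ huw
    exact (Eq.le h2).trans ((hm h1 h1' huw).trans (Eq.ge h2'))

end Cone

/-! ### The transport operator -/

section Transport

/-- The velocity `f_v`, set to zero at the two endpoints of `[0, 1]`, where `deriv f` need not be
controlled by the values of `f` on `[0, 1]`. -/
noncomputable def fluxVelocity (f : ℝ → EuclideanSpace ℝ (Fin n)) (u : unitInterval) (i : Fin n) :
    ℝ :=
  if (u : ℝ) ∈ Ioo 0 1 then deriv f u i else 0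

variable {f : ℝ → EuclideanSpace ℝ (Fin n)} {C : NNReal}

theorem measurable_fluxVelocity (f : ℝ → EuclideanSpace ℝ (Fin n)) :
    Measurable (fluxVelocity f) := by
  refine measurable_pi_lambda _ fun i => ?_
  refine Measurable.ite (measurable_subtype_coe measurableSet_Ioo) ?_ measurable_const
  exact (EuclideanSpace.proj (𝕜 := ℝ) i).continuous.measurable.comp
    ((measurable_deriv f).comp measurable_subtype_coe)

theorem abs_fluxVelocity_le (hf : LipschitzOnWith C f (Icc 0 1)) (u : unitInterval) (i : Fin n) :
    |fluxVelocity f u i| ≤ C := by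
  unfold fluxVelocity
  split_ifs with hu
  · exact (PiLp.norm_apply_le (deriv f u) i).trans
      (norm_deriv_le_of_lipschitzOn (Icc_mem_nhds hu.1 hu.2) hf)
  · simp

theorem deriv_eq_fluxVelocity (f : ℝ → EuclideanSpace ℝ (Fin n)) :
    ∀ᵐ p : Torus n L × unitInterval, ∀ i, deriv f (p.2 : ℝ) i = fluxVelocity f p.2 i := by
  have h : ∀ᵐ u : unitInterval, (u : ℝ) ∈ Ioo (0 : ℝ) 1 := by
    have h0 : ∀ᵐ u : unitInterval, u ≠ 0 := by simp [ae_iff, measure_singleton]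
    have h1 : ∀ᵐ u : unitInterval, u ≠ 1 := by simp [ae_iff, measure_singleton]
    filter_upwards [h0, h1] with u h0 h1
    exact ⟨unitInterval.pos_iff_ne_zero.2 h0, unitInterval.lt_one_iff_ne_one.2 h1⟩
  filter_upwards [Measure.quasiMeasurePreserving_snd.ae h] with p hp i
  rw [fluxVelocity, if_pos hp]

theorem isTransport_iff {Y B : KineticSpace n L} :
    IsTransport f Y B ↔ ∃ G : Fin n → KineticSpace n L, IsWeakGrad Y G ∧
      B =ᵐ[volume] fun p => ∑ i, fluxVelocity f p.2 i * G i p := by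
  refine exists_congr fun G => and_congr_right fun _ => ?_
  have h := deriv_eq_fluxVelocity (L := L) f
  constructor <;> intro hB <;> filter_upwards [hB, h] with p h1 h2
  · simpa only [h2] using h1
  · simpa only [h2] using h1

/-- The group `Y(x, u) ↦ Y(x - r f_v(u), u)` of free transport. -/
noncomputable def transportGroup (f : ℝ → EuclideanSpace ℝ (Fin n)) (L : ℝ) [Fact (0 < 2 * L)] :
    IsometryGroup (KineticSpace n L) :=
  (shearGroup (fluxVelocity f) (measurable_fluxVelocity f)).reverse

theorem IsTransport.hasDerivAt (hf : LipschitzOnWith C f (Icc 0 1)) {Y B : KineticSpace n L}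
    (h : IsTransport f Y B) : HasDerivAt (fun r => (transportGroup f L).map r Y) (-B) 0 := by
  obtain ⟨G, hG, hB⟩ := isTransport_iff.1 h
  exact IsometryGroup.hasDerivAt_reverse _
    (hasDerivAt_shearGroup _ (abs_fluxVelocity_le hf) hG hB)

theorem IsTransport.sub {Y Y' B B' : KineticSpace n L} (h : IsTransport f Y B)
    (h' : IsTransport f Y' B') : IsTransport f (Y - Y') (B - B') := by
  obtain ⟨G, hG, hB⟩ := h
  obtain ⟨G', hG', hB'⟩ := h'
  refine ⟨_, IsWeakGrad.sub hG hG', ?_⟩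
  filter_upwards [hB, hB', Lp.coeFn_sub B B', ae_all_iff.2 fun i => Lp.coeFn_sub (G i) (G' i)]
    with p h1 h2 h3 h4
  rw [h3, Pi.sub_apply, h1, h2, ← Finset.sum_sub_distrib]
  exact Finset.sum_congr rfl fun i _ => by rw [h4, Pi.sub_apply, mul_sub]

theorem IsTransport.inner_self (hf : LipschitzOnWith C f (Icc 0 1)) {Y B : KineticSpace n L}
    (h : IsTransport f Y B) : ⟪B, Y⟫ = 0 := by
  have h1 := (transportGroup f L).inner_generator (IsTransport.hasDerivAt hf h)
    (IsTransport.hasDerivAt hf h)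
  rw [inner_neg_left, inner_neg_right, real_inner_comm] at h1
  linarith

theorem exists_isTransport (hf : LipschitzOnWith C f (Icc 0 1)) {Y : KineticSpace n L} {M : ℝ}
    (hY : Y ∈ translationLipschitz n L M) :
    ∃ B, IsTransport f Y B ∧ ‖B‖ ≤ n * (C * M) := by
  obtain ⟨G, hG, hM⟩ := exists_isWeakGrad_of_mem hY
  have hci : ∀ i, Measurable fun u => fluxVelocity f u i := fun i =>
    (measurable_pi_apply i).comp (measurable_fluxVelocity f)
  have hCi : ∀ i u, |fluxVelocity f u i| ≤ C := fun i u => abs_fluxVelocity_le hf u i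
  refine ⟨∑ i, fiberMul _ (hci i) (hCi i) (G i), isTransport_iff.2 ⟨G, hG, ?_⟩, ?_⟩
  · filter_upwards [coeFn_finsetSum Finset.univ fun i => fiberMul _ (hci i) (hCi i) (G i),
      ae_all_iff.2 fun i => coeFn_fiberMul (hci i) (hCi i) (G i)] with p h1 h2
    rw [h1]
    exact Finset.sum_congr rfl fun i _ => h2 i
  · have h1 : ∀ i, ‖fiberMul _ (hci i) (hCi i) (G i)‖ ≤ C * M := by
      intro i
      refine (Lp.norm_le_mul_norm_of_ae_le_mul (c := C) (g := G i) ?_).trans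
        (mul_le_mul_of_nonneg_left (hM i) C.2)
      filter_upwards [coeFn_fiberMul (hci i) (hCi i) (G i)] with p hp
      rw [hp, norm_mul]
      exact mul_le_mul_of_nonneg_right (hCi i p.2) (norm_nonneg _)
    refine (norm_sum_le _ _).trans ((Finset.sum_le_sum fun i _ => h1 i).trans_eq ?_)
    simp

theorem proj_mem_translationLipschitz {P : KineticSpace n L → KineticSpace n L}
    (hP : IsMetricProjection (monotoneCone n L) P) {M : ℝ} {Y : KineticSpace n L}
    (hY : Y ∈ translationLipschitz n L M) : P Y ∈ translationLipschitz n L M := by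
  intro i r
  rw [← hP.map_comm ((coordGroup i).map r) ((coordGroup i).map (-r)) ((coordGroup i).map_map_neg r)
    (fun _ => coordGroup_mem_monotoneCone i r) (fun _ => coordGroup_mem_monotoneCone i (-r))]
  exact (hP.norm_sub_le _ _).trans (hY i r)

theorem isRegularClass_translationLipschitz (hf : LipschitzOnWith C f (Icc 0 1))
    {P : KineticSpace n L → KineticSpace n L}
    (hP : IsMetricProjection (monotoneCone n L) P) (M : NNReal) :
    IsRegularClass P (transportGroup f L) (translationLipschitz n L M) (n * (C * M)) where
  isClosed := isClosed_translationLipschitz _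
  map_mem r Y hY := by
    intro i s
    have h : (coordGroup i).map s ((transportGroup f L).map r Y) =
        (transportGroup f L).map r ((coordGroup i).map s Y) :=
      shearGroup_comm measurable_const (measurable_fluxVelocity f) s (-r) Y
    rw [h, ← map_sub, LinearIsometry.norm_map]
    exact hY i s
  proj_mem Y hY := proj_mem_translationLipschitz hP hY
  norm_le r Y hY := by
    obtain ⟨B, hB, hBn⟩ := exists_isTransport hf hY
    refine ((transportGroup f L).norm_map_sub_self_le (IsTransport.hasDerivAt hf hB) r).trans ?_
    rw [norm_neg]
    push_cast
    gcongr

/-- It suffices to test the inclusion with the regular elements of the cone: projections of test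
functions are regular, because the projection commutes with translations, and they are dense. -/
theorem mem_normalConeTo_of_regular {Z Y : KineticSpace n L}
    (h : ∀ W ∈ monotoneCone n L, ∀ M : ℝ, W ∈ translationLipschitz n L M → ⟪Z, W - Y⟫ ≤ 0) :
    Z ∈ normalConeTo (monotoneCone n L) Y := by
  obtain ⟨P, hP⟩ := exists_isMetricProjection ⟨_, zero_mem_monotoneCone⟩
    (isClosed_monotoneCone (n := n) (L := L)) convex_monotoneCone
  have hPc : Continuous P := (LipschitzWith.of_dist_le_mul (K := 1) fun x y => by
    simpa [dist_eq_norm] using hP.norm_sub_le x y).continuous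
  have hcl : IsClosed {W : KineticSpace n L | ⟪Z, P W - Y⟫ ≤ 0} :=
    isClosed_le (by fun_prop) continuous_const
  intro W hW
  have hall : W ∈ {W : KineticSpace n L | ⟪Z, P W - Y⟫ ≤ 0} := by
    refine closure_minimal ?_ hcl (dense_testLp W)
    rintro _ ⟨φ, hφ, rfl⟩
    have hG : IsWeakGrad (testLp φ hφ)
        (fun i => (testLp _ (isTestFunction_testPartial hφ i) : KineticSpace n L)) :=
      isWeakGrad_iff_hasDerivAt.2 fun i => hasDerivAt_coordGroup_testLp hφ i
    refine h _ (hP.mem _) _ (proj_mem_translationLipschitz hP (mem_translationLipschitz hG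
      (M := ∑ j, ‖(testLp _ (isTestFunction_testPartial hφ j) : KineticSpace n L)‖) fun i => ?_))
    exact Finset.single_le_sum
      (f := fun j => ‖(testLp _ (isTestFunction_testPartial hφ j) : KineticSpace n L)‖)
      (fun j _ => norm_nonneg _) (Finset.mem_univ i)
  simpa only [mem_ofPred_eq, hP.eq_self hW] using hall

end Transport

/-! ### Uniqueness and existence -/

section Solutions

variable {f : ℝ → EuclideanSpace ℝ (Fin n)} {C : NNReal} {Y₀ : KineticSpace n L}

theorem IsAdmissibleCurve.ae_hasDerivAt {Y : ℝ → KineticSpace n L}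
    (h : IsAdmissibleCurve Y₀ Y) :
    ∀ᵐ t ∂(volume.restrict (Ioi (0 : ℝ))), HasDerivAt Y (deriv Y t) t :=
  ae_hasDerivAt_of_eq_integral h.integrable_deriv h.eq_integral

/-- Solutions are unique since `f_v · ∇ₓ` is skew-symmetric and the normal cone is monotone. -/
theorem IsSolution.eqOn (hf : LipschitzOnWith C f (Icc 0 1)) {Y Y' : ℝ → KineticSpace n L}
    (h : IsSolution f Y₀ Y) (h' : IsSolution f Y₀ Y') : EqOn Y' Y (Ici 0) := by
  intro t ht
  refine sub_eq_zero.1 (eq_zero_of_inner_deriv_nonpos (W := fun t => Y' t - Y t)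
    (w := fun t => deriv Y' t - deriv Y t)
    (fun t ht => (h'.1.integrable_deriv t ht).sub (h.1.integrable_deriv t ht))
    (fun t ht => ?_) ?_ ht)
  · change Y' t - Y t = ∫ s in (0 : ℝ)..t, (deriv Y' s - deriv Y s)
    rw [intervalIntegral.integral_sub (h'.1.integrable_deriv t ht) (h.1.integrable_deriv t ht),
      h'.1.eq_integral t ht, h.1.eq_integral t ht, h'.1.initial, h.1.initial]
    abel
  · filter_upwards [h.2, h'.2, ae_restrict_mem measurableSet_Ioi] with t
      ⟨B, hB, hN⟩ ⟨B', hB', hN'⟩ ht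
    have ht : 0 ≤ t := le_of_lt ht
    -- Each inclusion is tested with the other solution.
    have h1 := hN (Y' t) (h'.1.mem_cone t ht)
    have h2 := hN' (Y t) (h.1.mem_cone t ht)
    have h3 := IsTransport.inner_self hf (IsTransport.sub hB' hB)
    have h4 : ⟪-(deriv Y' t + B'), Y t - Y' t⟫ = ⟪deriv Y' t + B', Y' t - Y t⟫ := by
      rw [inner_neg_left, ← inner_neg_right, neg_sub]
    rw [h4] at h2
    rw [inner_neg_left] at h1
    rw [inner_sub_left] at h3 ⊢
    rw [inner_add_left] at h1 h2
    linarith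

/-- Existence of a Lipschitz solution with bounded gradient. -/
theorem exists_isSolution (hf : LipschitzOnWith C f (Icc 0 1)) (hY₀ : Y₀ ∈ monotoneCone n L)
    {M : NNReal} (hM : Y₀ ∈ translationLipschitz n L M) :
    ∃ Y : ℝ → KineticSpace n L, IsSolution f Y₀ Y ∧ (∀ t, ‖deriv Y t‖ ≤ n * (C * M)) ∧
      ∀ t, Y t ∈ translationLipschitz n L M := by
  obtain ⟨P, hP⟩ := exists_isMetricProjection ⟨_, zero_mem_monotoneCone⟩
    (isClosed_monotoneCone (n := n) (L := L)) convex_monotoneCone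
  obtain ⟨Y, h0, hLip, hmem, hEVI⟩ := exists_splitting_limit isClosed_monotoneCone hP
    (isRegularClass_translationLipschitz hf hP M) hY₀ hM
  obtain ⟨hd, hi, heq⟩ := lipschitz_curve_ae_hasDerivAt hLip
  refine ⟨Y, ⟨⟨hLip.continuous.continuousOn, h0, fun t _ => (hmem t).1, hi, heq⟩, ?_⟩, fun t => ?_,
    fun t => (hmem t).2⟩
  · filter_upwards [hd, ae_restrict_mem measurableSet_Ioi] with t ht hpos
    obtain ⟨B, hB, -⟩ := exists_isTransport hf (hmem t).2
    refine ⟨B, hB, mem_normalConeTo_of_regular fun W hW M' hW' => ?_⟩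
    obtain ⟨b, hb, -⟩ := exists_isTransport hf hW'
    have h1 := hEVI W hW b (IsTransport.hasDerivAt hf hb) t (le_of_lt hpos) _ ht
    have h2 := IsTransport.inner_self hf (IsTransport.sub hB hb)
    rw [inner_neg_left, ← inner_neg_right, neg_sub, inner_add_left]
    rw [inner_sub_left] at h2
    linarith
  · simpa using norm_deriv_le_of_lipschitz (x₀ := t) hLip

end Solutions

end Kinetic

theorem mainTheorem1 (n : ℕ) (L : ℝ) [Fact (0 < 2 * L)]
    (f : ℝ → EuclideanSpace ℝ (Fin n)) (C : NNReal) (hf : LipschitzOnWith C f (Set.Icc 0 1))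
    (Y₀ : KineticSpace n L) (hY₀ : Y₀ ∈ monotoneCone n L)
    (hgrad : ∃ G : Fin n → KineticSpace n L, IsWeakGrad Y₀ G) :
    ∃ Y : ℝ → KineticSpace n L,
      -- `Y` is the solution of the Cauchy problem
      IsSolution f Y₀ Y ∧
      (∀ Y' : ℝ → KineticSpace n L, IsSolution f Y₀ Y' → Set.EqOn Y' Y (Set.Ici 0)) ∧
      -- its time derivative and its gradient are essentially bounded
      (∃ M : ℝ, ∀ᵐ t ∂(volume.restrict (Set.Ioi (0 : ℝ))), ‖deriv Y t‖ ≤ M ∧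
        ∃ G : Fin n → KineticSpace n L, IsWeakGrad (Y t) G ∧ ∀ i, ‖G i‖ ≤ M) ∧
      -- it is slow, and its time derivative minimizes the interaction functional
      (∀ᵐ t ∂(volume.restrict (Set.Ioi (0 : ℝ))), SlowAt f Y t) ∧
      (∀ᵐ t ∂(volume.restrict (Set.Ioi (0 : ℝ))), MinimalInteractionAt f Y t ∧
        deriv Y t ∈ tangentConeTo (monotoneCone n L) (Y t)) ∧
      -- conversely, each of the two conditions determines it
      (∀ Y' : ℝ → KineticSpace n L, IsAdmissibleCurve Y₀ Y' →
        (∀ᵐ t ∂(volume.restrict (Set.Ioi (0 : ℝ))), SlowAt f Y' t) →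
          Set.EqOn Y' Y (Set.Ici 0)) ∧
      (∀ Y' : ℝ → KineticSpace n L, IsAdmissibleCurve Y₀ Y' →
        (∀ᵐ t ∂(volume.restrict (Set.Ioi (0 : ℝ))), MinimalInteractionAt f Y' t) →
          Set.EqOn Y' Y (Set.Ici 0)) := by
  obtain ⟨G₀, hG₀⟩ := hgrad
  obtain ⟨Y, hsol, hderiv, hmem⟩ := Kinetic.exists_isSolution (M := ∑ j, ‖G₀ j‖₊) hf hY₀
    (Kinetic.mem_translationLipschitz hG₀ fun i => by
      exact_mod_cast Finset.single_le_sum (f := fun j => ‖G₀ j‖₊) (fun j _ => zero_le)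
        (Finset.mem_univ i))
  have hcone : ∀ Y' : ℝ → KineticSpace n L, IsAdmissibleCurve Y₀ Y' →
      ∀ᵐ t ∂(volume.restrict (Set.Ioi (0 : ℝ))),
        deriv Y' t ∈ tangentConeTo (monotoneCone n L) (Y' t) ∧
          -deriv Y' t ∈ tangentConeTo (monotoneCone n L) (Y' t) := by
    intro Y' hY'
    filter_upwards [Kinetic.IsAdmissibleCurve.ae_hasDerivAt hY',
      ae_restrict_mem measurableSet_Ioi] with t ht hpos
    exact Kinetic.deriv_mem_tangentConeTo hY'.mem_cone hpos ht
  refine ⟨Y, hsol, fun Y' hY' => Kinetic.IsSolution.eqOn hf hsol hY', ?_, ?_, ?_, ?_, ?_⟩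
  · refine ⟨max (n * (C * ((∑ j, ‖G₀ j‖₊ : NNReal) : ℝ))) ((∑ j, ‖G₀ j‖₊ : NNReal) : ℝ),
      ae_of_all _ fun t => ⟨(hderiv t).trans (le_max_left _ _), ?_⟩⟩
    obtain ⟨G, hG, hGn⟩ := Kinetic.exists_isWeakGrad_of_mem (hmem t)
    exact ⟨G, hG, fun i => (hGn i).trans (le_max_right _ _)⟩
  · filter_upwards [hsol.2, hcone Y hsol.1] with t ⟨B, hB, hN⟩ ⟨h1, h2⟩
    exact ⟨B, hB, Kinetic.isLeast_norm_deriv h1 h2 hN, _, hN, by simp⟩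
  · filter_upwards [hsol.2, hcone Y hsol.1] with t ⟨B, hB, hN⟩ ⟨h1, h2⟩
    exact ⟨⟨B, hB, Kinetic.isLeast_norm_deriv_add h1 h2 hN⟩, h1⟩
  · intro Y' hY' hslow
    refine Kinetic.IsSolution.eqOn hf hsol ⟨hY', ?_⟩
    filter_upwards [hslow] with t ⟨B, hB, _, Z, hZ, hZB⟩
    refine ⟨B, hB, ?_⟩
    have h : -(deriv Y' t + B) = Z := by
      have h1 : Z + B = -deriv Y' t := hZB
      rw [neg_add, ← h1, add_neg_cancel_right]
    rwa [h]
  · intro Y' hY' hmin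
    refine Kinetic.IsSolution.eqOn hf hsol ⟨hY', ?_⟩
    filter_upwards [hmin, hcone Y' hY'] with t ⟨B, hB, hleast⟩ ⟨h1, _⟩
    exact ⟨B, hB, Kinetic.neg_mem_normalConeTo_of_isLeast Kinetic.convex_monotoneCone h1 hleast⟩
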